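/- **Setting.** Let $S$, $\Phi$, $B$ be measurable spaces (for instance Borel subsets of Euclidean spaces) in which a hidden state $\xi_t$, an observed state $\varphi_t$ and a (finite-dimensional) belief statistic $\hat\xi_t$ take their values. Let $Q_\varphi(\cdot\mid\xi)$ be the conditional law of $\varphi_{t+1}$ given $\xi_t=\xi$ (hidden Markov structure; the law of motion of $\xi_t$ itself does not enter the recursion), let $\Pi_\xi(\cdot\mid\hat\xi)$ be the belief about $\xi_t$ given $\hat\xi_t=\hat\xi$ (both are probability kernels), and let beliefs be updated by a time-invariant measurable rule $\hat\xi_{t+1}=\Xi(\hat\xi_t,\varphi_{t+1})$. Let $\hat Q$ be the resulting conditional law of $\hat X_{t+1}=(\varphi_{t+1},\hat\xi_{t+1})$ given $\hat X_t=(\varphi_t,\hat\xi_t)$: draw $\xi_t\sim\Pi_\xi(\cdot\mid\hat\xi_t)$, then $\varphi_{t+1}\sim Q_\varphi(\cdot\mid\xi_t)$, and put $\hat\xi_{t+1}=\Xi(\hat\xi_t,\varphi_{t+1})$. Let $\mu$ be a stationary probability law of $\hat X_t$ under $\hat Q$. **Function spaces.** For $s\ge 1$ and a function $f$ of $\varphi$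 or of $\hat\xi$, measurable and identified up to $\mu$-a.e. equality, write $f\in E^{\phi_s}_{\varphi}$, respectively $f\in E^{\phi_s}_{\hat\xi}$, if $\mathbb E^\mu[\exp(|f/c|^s)]<\infty$ for every $c>0$. These spaces carry the $\mu$-a.e. order and the norm $\|f\|_{\phi_s}=\inf\{c>0:\mathbb E^\mu[\exp(|f/c|^s)]\le 2\}$. **Operator.** Let $\beta\in(0,1)$, $\theta\in(0,\infty)$, $\vartheta\in(0,\infty]$, $\alpha\in\mathbb R$ and $u:\Phi\to\mathbb R$ (in the applications $\alpha=-1/(\vartheta(1-\beta))$ if $\vartheta<\infty$ and $\alpha=-1/(\theta(1-\beta))$ if $\vartheta=\infty$). For $f:B\to\mathbb R$ let $$\mathbb T f(\hat\xi)=\beta\log\mathbb E^{\Pi_\xi}\big[J_f(\xi_t,\hat\xi)\,\big|\,\hat\xi_t=\hat\xi\big],$$ where $$J_f(\xi,\hat\xi)=\mathbb E^{Q_\varphi}\Big[e^{\frac{\theta}{\vartheta}f(\Xi(\hat\xi,\varphi_{t+1}))+\alpha u(\varphi_{t+1})}\,\Big|\,\xi_t=\xi\Big]^{\vartheta/\theta}\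 \ (\vartheta<\infty),\qquad J_f(\xi,\hat\xi)=e^{\mathbb E^{Q_\varphi}[f(\Xi(\hat\xi,\varphi_{t+1}))+\alpha u(\varphi_{t+1})\mid\xi_t=\xi]}\ \ (\vartheta=\infty).$$ The case $\vartheta<\infty$ is the Hansen–Sargent and Ju–Miao recursion, and $\vartheta=\infty$ is its Klibanoff–Marinacci–Mukerji limit. The subgradient of $\mathbb T$ at $v$ is $$\mathbb D_v f(\hat\xi)=\beta\,\mathbb E^{\Pi_\xi}\Big[\mathbb E^{Q_\varphi}\big[m_v\,f(\Xi(\hat\xi,\varphi_{t+1}))\,\big|\,\xi_t\big]\,\Big|\,\hat\xi_t=\hat\xi\Big],\qquad m_v=\frac{J_v(\xi_t,\hat\xi)}{\mathbb E^{\Pi_\xi}[J_v(\xi_t,\hat\xi)\mid\hat\xi_t=\hat\xi]}\cdot q_v,$$ where $q_v=e^{\frac{\theta}{\vartheta}v(\Xi(\hat\xi,\varphi_{t+1}))+\alpha u(\varphi_{t+1})}\big/\mathbb E^{Q_\varphi}\big[e^{\frac{\theta}{\vartheta}v(\Xi(\hat\xi,\varphi_{t+1}))+\alpha u(\varphi_{t+1})}\mid\xi_t\big]$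 if $\vartheta<\infty$ and $q_v=1$ if $\vartheta=\infty$. A fixed point $v$ of $\mathbb T$ in $E^{\phi_1}_{\hat\xi}$ is called stable if $\mathbb D_v$ is a bounded linear operator on $E^{\phi_1}_{\hat\xi}$ with spectral radius $\lim_{n\to\infty}\|\mathbb D_v^n\|^{1/n}<1$. **Theorem.** Let $r\ge 1$ and $u\in E^{\phi_r}_{\varphi}$. Then, for every $s\in[1,r]$, all expectations in $\mathbb T f$ are finite $\mu$-a.e. for $f\in E^{\phi_s}_{\hat\xi}$, and $\mathbb T$ maps $E^{\phi_s}_{\hat\xi}$ into itself. Moreover $\mathbb T$ has a fixed point $v\in E^{\phi_r}_{\hat\xi}$. If $r>1$, then (i) $v$ is the unique fixed point of $\mathbb T$ in $E^{\phi_s}_{\hat\xi}$ for every $s\in(1,r]$, and (ii) $v$ is both the smallest fixed point and the unique stable fixed point of $\mathbb T$ in $E^{\phi_1}_{\hat\xi}$. -/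

import Mathlib

open MeasureTheory ProbabilityTheory Filter Topology
open scoped ENNReal

noncomputable section

/-! ### Exponential Orlicz hearts -/

/-- The exponential moment `E^μ[exp(|f / c|^r)]`, with values in `[0, ∞]`. -/
def expMoment {X : Type*} [MeasurableSpace X] (r : ℝ) (μ : Measure X) (f : X → ℝ) (c : ℝ) :
    ℝ≥0∞ :=
  ∫⁻ x, ENNReal.ofReal (Real.exp (|f x / c| ^ r)) ∂μ

/-- Membership in the Orlicz heart `E^{φ_r}(μ)`. Functions are identified when they agree
`μ`-almost everywhere, and they are ordered by `≤` `μ`-almost everywhere. -/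
def MemOrliczHeart {X : Type*} [MeasurableSpace X] (r : ℝ) (μ : Measure X) (f : X → ℝ) : Prop :=
  AEMeasurable f μ ∧ ∀ c : ℝ, 0 < c → expMoment r μ f c < ∞

/-- The Luxemburg norm `inf {c > 0 : E^μ[exp(|f / c|^r)] ≤ 2}`; it is `∞` if there is no such
`c`. -/
def luxNorm {X : Type*} [MeasurableSpace X] (r : ℝ) (μ : Measure X) (f : X → ℝ) : ℝ≥0∞ :=
  ⨅ (c : ℝ) (_ : 0 < c) (_ : expMoment r μ f c ≤ 2), ENNReal.ofReal c

/-- The operator norm `sup {‖D f‖ : f ∈ E^{φ_r}(μ), ‖f‖ = 1}`. -/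
def heartOpNorm {X : Type*} [MeasurableSpace X] (r : ℝ) (μ : Measure X)
    (D : (X → ℝ) → (X → ℝ)) : ℝ≥0∞ :=
  ⨆ (f : X → ℝ) (_ : MemOrliczHeart r μ f) (_ : luxNorm r μ f = 1), luxNorm r μ (D f)

/-- `D` induces a bounded linear operator from `E^{φ_r}(μ)` to itself. -/
structure IsBoundedLinearOnHeart {X : Type*} [MeasurableSpace X] (r : ℝ) (μ : Measure X)
    (D : (X → ℝ) → (X → ℝ)) : Prop where
  mapsTo : ∀ f, MemOrliczHeart r μ f → MemOrliczHeart r μ (D f)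
  congr : ∀ f g, MemOrliczHeart r μ f → MemOrliczHeart r μ g → f =ᵐ[μ] g → D f =ᵐ[μ] D g
  add : ∀ f g, MemOrliczHeart r μ f → MemOrliczHeart r μ g →
    D (fun x => f x + g x) =ᵐ[μ] fun x => D f x + D g x
  smul : ∀ (a : ℝ) (f : X → ℝ), MemOrliczHeart r μ f →
    D (fun x => a * f x) =ᵐ[μ] fun x => a * D f x
  bounded : heartOpNorm r μ D < ∞

/-- `ρ` is the spectral radius `lim ‖D^n‖^{1/n}` of `D` on `E^{φ_r}(μ)`. -/
def IsHeartSpectralRadius {X : Type*} [MeasurableSpace X] (r : ℝ) (μ : Measure X)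
    (D : (X → ℝ) → (X → ℝ)) (ρ : ℝ≥0∞) : Prop :=
  Tendsto (fun n : ℕ => heartOpNorm r μ (D^[n]) ^ (1 / (n : ℝ))) atTop (𝓝 ρ)

/-! ### The learning environment -/

/-- The parts of a hidden Markov learning environment that enter the recursion. `S`, `Φ`, `B` are
the spaces of the hidden state `ξ_t`, the observed state `φ_t` and the belief statistic `ξ̂_t`. -/
structure LearningModel (S Φ B : Type*) [MeasurableSpace S] [MeasurableSpace Φ]
    [MeasurableSpace B] where
  /-- `Q_φ`, the conditional law of `φ_{t+1}` given `ξ_t`. -/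
  obs : Kernel S Φ
  /-- `Π_ξ`, the posterior law of `ξ_t` given the belief statistic `ξ̂_t`. -/
  post : Kernel B S
  /-- The updating rule `ξ̂_{t+1} = Ξ(ξ̂_t, φ_{t+1})`. -/
  upd : B → Φ → B
  obs_markov : IsMarkovKernel obs
  post_markov : IsMarkovKernel post
  measurable_upd : Measurable (fun p : B × Φ => upd p.1 p.2)

attribute [instance] LearningModel.obs_markov LearningModel.post_markov

namespace LearningModel

variable {S Φ B : Type*} [MeasurableSpace S] [MeasurableSpace Φ] [MeasurableSpace B]

/-- The conditional law of `X̂_{t+1} = (φ_{t+1}, ξ̂_{t+1})` given `X̂_t = (φ_t, ξ̂_t)`: draw `ξ_t`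
from `Π_ξ(· | ξ̂_t)`, then `φ_{t+1}` from `Q_φ(· | ξ_t)`, and set
`ξ̂_{t+1} = Ξ(ξ̂_t, φ_{t+1})`. -/
def transition (M : LearningModel S Φ B) : Kernel (Φ × B) (Φ × B) :=
  ((Kernel.id ×ₖ (M.obs ∘ₖ M.post)).map (fun p : B × Φ => (p.2, M.upd p.1 p.2))).comap
    Prod.snd measurable_snd

/-- The law `μ` of `X̂_t = (φ_t, ξ̂_t)` is stationary. Its marginals `μ.fst` and `μ.snd` are the
stationary laws of `φ_t` and `ξ̂_t`. -/
def IsStationary (M : LearningModel S Φ B) (μ : Measure (Φ × B)) : Prop :=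
  Kernel.Invariant M.transition μ

/-- The random variable in the inner expectation, as a function of `ξ̂_t = b` and `φ_{t+1} = y`:
`exp((θ/ϑ) f(Ξ(b, y)) + α u(y))` if `ϑ < ∞`, and `f(Ξ(b, y)) + α u(y)` if `ϑ = ∞`. -/
def innerIntegrand (M : LearningModel S Φ B) (θ : ℝ) (ϑ : ℝ≥0∞) (α : ℝ) (u : Φ → ℝ)
    (f : B → ℝ) (b : B) (y : Φ) : ℝ :=
  if ϑ = ∞ then f (M.upd b y) + α * u y
  else Real.exp (θ / ϑ.toReal * f (M.upd b y) + α * u y)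

/-- The random variable in the outer expectation, as a function of `ξ_t = x` and `ξ̂_t = b`:
`E^{Q_φ}[exp((θ/ϑ) f(ξ̂_{t+1}) + α u(φ_{t+1}))]^{ϑ/θ}` if `ϑ < ∞`, and
`exp(E^{Q_φ}[f(ξ̂_{t+1}) + α u(φ_{t+1})])` if `ϑ = ∞`. -/
def outerIntegrand (M : LearningModel S Φ B) (θ : ℝ) (ϑ : ℝ≥0∞) (α : ℝ) (u : Φ → ℝ)
    (f : B → ℝ) (b : B) (x : S) : ℝ :=
  if ϑ = ∞ then Real.exp (∫ y, M.innerIntegrand θ ϑ α u f b y ∂(M.obs x))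
  else (∫ y, M.innerIntegrand θ ϑ α u f b y ∂(M.obs x)) ^ (ϑ.toReal / θ)

/-- The recursion operator `T`. -/
def T (M : LearningModel S Φ B) (β θ : ℝ) (ϑ : ℝ≥0∞) (α : ℝ) (u : Φ → ℝ) (f : B → ℝ) (b : B) :
    ℝ :=
  β * Real.log (∫ x, M.outerIntegrand θ ϑ α u f b x ∂(M.post b))

/-- All expectations in `T f (b)` are finite for almost every belief `b`. -/
def HasFiniteExpectations (M : LearningModel S Φ B) (μ : Measure (Φ × B)) (θ : ℝ) (ϑ : ℝ≥0∞)
    (α : ℝ) (u : Φ → ℝ) (f : B → ℝ) : Prop :=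
  ∀ᵐ b ∂μ.snd,
    (∀ᵐ x ∂(M.post b), Integrable (M.innerIntegrand θ ϑ α u f b) (M.obs x)) ∧
      Integrable (M.outerIntegrand θ ϑ α u f b) (M.post b)

/-- The change of measure `m_v^{Π_ξ}(x, b)` that distorts the posterior of the hidden state. -/
def distortPost (M : LearningModel S Φ B) (θ : ℝ) (ϑ : ℝ≥0∞) (α : ℝ) (u : Φ → ℝ)
    (v : B → ℝ) (b : B) (x : S) : ℝ :=
  M.outerIntegrand θ ϑ α u v b x / ∫ x', M.outerIntegrand θ ϑ α u v b x' ∂(M.post b)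

/-- The change of measure `m_v^{Q_φ}(x, b, y)` that distorts `Q_φ`; there is no distortion of
`Q_φ` if `ϑ = ∞`. -/
def distortObs (M : LearningModel S Φ B) (θ : ℝ) (ϑ : ℝ≥0∞) (α : ℝ) (u : Φ → ℝ)
    (v : B → ℝ) (b : B) (x : S) (y : Φ) : ℝ :=
  if ϑ = ∞ then 1
  else M.innerIntegrand θ ϑ α u v b y / ∫ y', M.innerIntegrand θ ϑ α u v b y' ∂(M.obs x)

/-- The subgradient `D_v` of `T` at `v`: the discounted conditional expectation of `f(ξ̂_{t+1})`
given `ξ̂_t = b` under the distorted law. -/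
def D (M : LearningModel S Φ B) (β θ : ℝ) (ϑ : ℝ≥0∞) (α : ℝ) (u : Φ → ℝ) (v f : B → ℝ) (b : B) :
    ℝ :=
  β * ∫ x, ∫ y, M.distortPost θ ϑ α u v b x * M.distortObs θ ϑ α u v b x y * f (M.upd b y)
    ∂(M.obs x) ∂(M.post b)

/-- `v ∈ E^{φ_s}_{ξ̂}` is a fixed point of `T`. -/
def IsFixedPointIn (M : LearningModel S Φ B) (μ : Measure (Φ × B)) (β θ : ℝ) (ϑ : ℝ≥0∞) (α : ℝ)
    (u : Φ → ℝ) (s : ℝ) (v : B → ℝ) : Prop :=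
  MemOrliczHeart s μ.snd v ∧ M.T β θ ϑ α u v =ᵐ[μ.snd] v

/-- `v` is stable in `E^{φ_s}_{ξ̂}`: `D_v` is a bounded linear operator on that space with
spectral radius less than one. -/
def IsStableIn (M : LearningModel S Φ B) (μ : Measure (Φ × B)) (β θ : ℝ) (ϑ : ℝ≥0∞) (α : ℝ)
    (u : Φ → ℝ) (s : ℝ) (v : B → ℝ) : Prop :=
  IsBoundedLinearOnHeart s μ.snd (M.D β θ ϑ α u v) ∧
    ∃ ρ : ℝ≥0∞, IsHeartSpectralRadius s μ.snd (M.D β θ ϑ α u v) ρ ∧ ρ < 1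

end LearningModel

end

/-! Write `C_k(Y) = k⁻¹ log E[exp(kY)]`, with `C_0 = E`. Up to rescaling the payoff, the operator is
`β` times two nested certainty equivalents: `C_k` under `Q_φ` with `k = θ/ϑ` (zero when `ϑ = ∞`),
then `C_1` under `Π_ξ` (`outerIntegrand_eq`, `IsStationary.T_ae_eq`). Each `C_k` is monotone and
convex, and its subgradient is an expectation under a Gibbs change of measure
(`certEq_add_gibbs_le`). Hence the operator is monotone and satisfies `T v + D_v (w - v) ≤ T w` with
`D_v` positive. Stationarity turns one-step moments back into moments under `μ`
(`IsStationary.map_jointLaw`).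

Existence. Certainty equivalents preserve exponential moments of every order `s ≥ 1` up to an
additive constant (`ofReal_exp_abs_certEq_le`). This gives a drift inequality with factor `β < 1`
(`expMoment_recT_le`), so monotone iteration from a subsolution stays bounded in moments and
converges to a fixed point (`exists_fixedPoint_of_subsolution`). The subsolution is `-w`, where `w`
solves the risk-neutral recursion with payoff `|U|`. Every supersolution lies above `-w`, because
the risk-neutral recursion is affine with a linear part of spectral radius `β`; so the limit `v` is
the smallest fixed point (`exists_least_fixedPoint`).

Stability. If the value and the payoff lie in a heart of order `s > 1`, so do the log-densities of
the changes of measure. Their exponential moments of order `1/ε` are then at most of size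
`exp(ε^(-q))`, with `q = s/(s-1)`. By Young's inequality, one application of `D_v` costs a factor
`(1-ε)²` in the exponent. Taking `ε = 1/(4n)` over `n` steps gives `‖D_v^n‖ ≤ A β^n n^q`, while
constants give `‖D_v^n‖ ≥ β^n`; the spectral radius is `β` (`recD_stable`).

Uniqueness. If `w` is a stable fixed point, the subgradient inequality at `w` gives `w - v ≤ D_w (w
- v)`. Iterating this forces `w ≤ v` (`le_of_stable`), and minimality of `v` gives equality. Fixed
points in a heart of order `s > 1` are automatically stable, which gives uniqueness there. -/

noncomputable section

/-! ### Exponential moments and Orlicz hearts. -/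

section Hearts

variable {X : Type*} [MeasurableSpace X] {ρ : Measure X} {r s c : ℝ} {f g : X → ℝ}

theorem expMoment_mono (hr : 0 ≤ r) (h : ∀ᵐ x ∂ρ, |f x| ≤ |g x|) :
    expMoment r ρ f c ≤ expMoment r ρ g c := by
  refine lintegral_mono_ae ?_
  filter_upwards [h] with x hx
  refine ENNReal.ofReal_le_ofReal (Real.exp_le_exp.2 (Real.rpow_le_rpow (abs_nonneg _) ?_ hr))
  rw [abs_div, abs_div]
  gcongr

theorem expMoment_congr (h : f =ᵐ[ρ] g) : expMoment r ρ f c = expMoment r ρ g c :=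
  lintegral_congr_ae (h.mono fun x hx => by simp only [hx])

theorem expMoment_anti (hr : 0 ≤ r) (hc : 0 < c) {c' : ℝ} (hcc : c ≤ c') :
    expMoment r ρ f c' ≤ expMoment r ρ f c := by
  refine lintegral_mono fun x => ?_
  refine ENNReal.ofReal_le_ofReal (Real.exp_le_exp.2 (Real.rpow_le_rpow (abs_nonneg _) ?_ hr))
  rw [abs_div, abs_div, abs_of_pos hc, abs_of_pos (hc.trans_le hcc)]
  gcongr

theorem expMoment_const_mul (a : ℝ) :
    expMoment r ρ (fun x => a * f x) c = expMoment r ρ f (c / a) := by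
  unfold expMoment
  congr with x
  rw [div_div_eq_mul_div, mul_comm]

theorem expMoment_abs : expMoment r ρ (fun x => |f x|) c = expMoment r ρ f c := by
  unfold expMoment
  congr with x
  rw [abs_div, abs_div, abs_abs]

/-- Convexity of `x ↦ exp (|x| ^ r)`, integrated. -/
theorem expMoment_add_le (hr : 1 ≤ r) {β : ℝ} (hβ0 : 0 < β) (hβ1 : β < 1)
    (hf : AEMeasurable f ρ) :
    expMoment r ρ (fun x => f x + g x) c ≤ ENNReal.ofReal β * expMoment r ρ f (c * β) +
      ENNReal.ofReal (1 - β) * expMoment r ρ g (c * (1 - β)) := by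
  have hβ1' : 0 < 1 - β := by linarith
  unfold expMoment
  have hm : AEMeasurable (fun x => ENNReal.ofReal (Real.exp (|f x / (c * β)| ^ r))) ρ := by
    fun_prop
  rw [← lintegral_const_mul'' _ hm, ← lintegral_const_mul' _ _ ENNReal.ofReal_ne_top,
    ← lintegral_add_left' (hm.const_mul _)]
  refine lintegral_mono fun x => ?_
  rw [← ENNReal.ofReal_mul hβ0.le, ← ENNReal.ofReal_mul hβ1'.le,
    ← ENNReal.ofReal_add (by positivity) (by positivity)]
  refine ENNReal.ofReal_le_ofReal ?_
  -- The sum is the convex combination of the rescaled functions `p` and `q`; convexity of the power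
  -- and of `exp` does the rest.
  set p := f x / (c * β)
  set q := g x / (c * (1 - β))
  have e1 : |(f x + g x) / c| ≤ β * |p| + (1 - β) * |q| := by
    have : (f x + g x) / c = β * p + (1 - β) * q := by
      simp only [p, q]
      by_cases hc : c = 0
      · simp [hc]
      · field_simp
    rw [this]
    refine (abs_add_le _ _).trans_eq ?_
    rw [abs_mul, abs_mul, abs_of_pos hβ0, abs_of_pos hβ1']
  have e2 : |(f x + g x) / c| ^ r ≤ β * |p| ^ r + (1 - β) * |q| ^ r := by
    refine (Real.rpow_le_rpow (abs_nonneg _) e1 (by linarith)).trans ?_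
    have := (convexOn_rpow hr).2 (Set.mem_Ici.2 (abs_nonneg p)) (Set.mem_Ici.2 (abs_nonneg q))
      hβ0.le hβ1'.le (by ring)
    simpa using this
  refine (Real.exp_le_exp.2 e2).trans ?_
  have := convexOn_exp.2 (Set.mem_univ (|p| ^ r)) (Set.mem_univ (|q| ^ r))
      hβ0.le hβ1'.le (by ring)
  simpa using this

namespace MemOrliczHeart

theorem mono (hr : 0 ≤ r) (hf : MemOrliczHeart r ρ f) (hg : AEMeasurable g ρ)
    (h : ∀ᵐ x ∂ρ, |g x| ≤ |f x|) : MemOrliczHeart r ρ g :=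
  ⟨hg, fun c hc => (expMoment_mono hr h).trans_lt (hf.2 c hc)⟩

theorem congr (hf : MemOrliczHeart r ρ f) (h : f =ᵐ[ρ] g) : MemOrliczHeart r ρ g :=
  ⟨hf.1.congr h, fun c hc => (expMoment_congr h) ▸ hf.2 c hc⟩

theorem abs (hf : MemOrliczHeart r ρ f) : MemOrliczHeart r ρ (fun x => |f x|) :=
  ⟨hf.1.abs, fun c hc => by rw [expMoment_abs]; exact hf.2 c hc⟩

theorem const [IsFiniteMeasure ρ] (a : ℝ) : MemOrliczHeart r ρ (fun _ => a) :=
  ⟨aemeasurable_const, fun c _ => by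
    simp only [expMoment, lintegral_const]
    exact ENNReal.mul_lt_top ENNReal.ofReal_lt_top (measure_lt_top _ _)⟩

theorem add (hr : 1 ≤ r) (hf : MemOrliczHeart r ρ f) (hg : MemOrliczHeart r ρ g) :
    MemOrliczHeart r ρ (fun x => f x + g x) :=
  ⟨hf.1.add hg.1, fun c hc => by
    refine (expMoment_add_le hr (β := 1 / 2) (by norm_num) (by norm_num) hf.1).trans_lt ?_
    exact ENNReal.add_lt_top.2 ⟨ENNReal.mul_lt_top ENNReal.ofReal_lt_top (hf.2 _ (by positivity)),
      ENNReal.mul_lt_top ENNReal.ofReal_lt_top (hg.2 _ (by linarith))⟩⟩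

theorem neg (hf : MemOrliczHeart r ρ f) : MemOrliczHeart r ρ (fun x => -f x) :=
  ⟨hf.1.neg, fun c hc => by
    have := hf.abs.2 c hc
    have h2 := expMoment_abs (r := r) (ρ := ρ) (f := fun x => -f x) (c := c)
    simp only [abs_neg] at h2
    rwa [← h2]⟩

theorem sub (hr : 1 ≤ r) (hf : MemOrliczHeart r ρ f) (hg : MemOrliczHeart r ρ g) :
    MemOrliczHeart r ρ (fun x => f x - g x) := by
  simpa only [sub_eq_add_neg] using hf.add hr hg.neg

theorem const_mul [IsFiniteMeasure ρ] (a : ℝ) (hf : MemOrliczHeart r ρ f) :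
    MemOrliczHeart r ρ (fun x => a * f x) := by
  by_cases ha : a = 0
  · simpa [ha] using const (r := r) (ρ := ρ) (0 : ℝ)
  refine ⟨hf.1.const_mul a, fun c hc => ?_⟩
  have h := hf.2 (c / |a|) (by positivity)
  rw [← expMoment_const_mul] at h
  rw [← expMoment_abs] at h ⊢
  simpa only [abs_mul, abs_abs] using h

/-- Splitting at `|f / c| = 1` gives `|f / c| ^ s ≤ 1 + |f / c| ^ r`, so the moments compare up to a
factor `e`. -/
theorem of_le (hs : 0 ≤ s) (hsr : s ≤ r) (hf : MemOrliczHeart r ρ f) :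
    MemOrliczHeart s ρ f := by
  refine ⟨hf.1, fun c hc => ?_⟩
  have h : expMoment s ρ f c ≤ ENNReal.ofReal (Real.exp 1) * expMoment r ρ f c := by
    unfold expMoment
    rw [← lintegral_const_mul' _ _ ENNReal.ofReal_ne_top]
    refine lintegral_mono fun x => ?_
    rw [← ENNReal.ofReal_mul (by positivity), ← Real.exp_add]
    refine ENNReal.ofReal_le_ofReal (Real.exp_le_exp.2 ?_)
    rcases le_total |f x / c| 1 with h1 | h1
    · have := Real.rpow_le_one (abs_nonneg _) h1 hs
      have : 0 ≤ |f x / c| ^ r := by positivity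
      linarith
    · have := Real.rpow_le_rpow_of_exponent_le h1 hsr
      linarith
  exact h.trans_lt (ENNReal.mul_lt_top ENNReal.ofReal_lt_top (hf.2 c hc))

theorem integrable_exp_mul_abs (hf : MemOrliczHeart 1 ρ f) {t : ℝ} (ht : 0 < t) :
    Integrable (fun x => Real.exp (t * |f x|)) ρ := by
  refine ⟨by have := hf.1; fun_prop, ?_⟩
  rw [hasFiniteIntegral_iff_ofReal (ae_of_all _ fun x => by positivity)]
  have := hf.2 t⁻¹ (by positivity)
  simp only [expMoment, div_inv_eq_mul, abs_mul, abs_of_pos ht, Real.rpow_one] at this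
  simpa only [mul_comm] using this

theorem integrable_exp (hf : MemOrliczHeart 1 ρ f) : Integrable (fun x => Real.exp (f x)) ρ := by
  refine (hf.integrable_exp_mul_abs one_pos).mono' (by have := hf.1; fun_prop)
    (ae_of_all _ fun x => ?_)
  rw [Real.norm_of_nonneg (by positivity), one_mul]
  exact Real.exp_le_exp.2 (le_abs_self _)

theorem integrable (hf : MemOrliczHeart 1 ρ f) : Integrable f ρ := by
  refine (hf.integrable_exp_mul_abs one_pos).mono' hf.1.aestronglyMeasurable
    (ae_of_all _ fun x => ?_)
  rw [Real.norm_eq_abs, one_mul]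
  linarith [Real.add_one_le_exp |f x|]

/-- Exponentially weighted functions in the heart are integrable. -/
theorem integrable_exp_mul (hf : MemOrliczHeart 1 ρ f) (hg : MemOrliczHeart 1 ρ g) :
    Integrable (fun x => Real.exp (f x) * g x) ρ := by
  refine ((hf.add le_rfl hg.abs).integrable_exp).mono'
    (by have := hf.1; have := hg.1.aestronglyMeasurable; fun_prop) (ae_of_all _ fun x => ?_)
  rw [norm_mul, Real.norm_of_nonneg (by positivity), Real.norm_eq_abs, Real.exp_add]
  gcongr
  linarith [Real.add_one_le_exp |g x|]

end MemOrliczHeart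

theorem expMoment_comp {Z : Type*} [MeasurableSpace Z] {φ : X → Z} (hφ : Measurable φ)
    {h : Z → ℝ} (hh : AEMeasurable h (ρ.map φ)) :
    expMoment r ρ (fun x => h (φ x)) c = expMoment r (ρ.map φ) h c := by
  unfold expMoment
  rw [lintegral_map' (by fun_prop) hφ.aemeasurable]

theorem MemOrliczHeart.comp {Z : Type*} [MeasurableSpace Z] {φ : X → Z} (hφ : Measurable φ)
    {h : Z → ℝ} (hh : MemOrliczHeart r (ρ.map φ) h) :
    MemOrliczHeart r ρ (fun x => h (φ x)) :=
  ⟨hh.1.comp_measurable hφ, fun c hc => by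
    rw [expMoment_comp hφ hh.1]; exact hh.2 c hc⟩

/-- Tail bound: in a heart of order `s > 1`, exponential moments of order `t` grow at most like
`exp (t ^ (s / (s - 1)))`. -/
theorem lintegral_exp_mul_abs_le [IsProbabilityMeasure ρ] (hs : 1 < s) {t : ℝ} (ht : 0 < t) :
    ∫⁻ x, ENNReal.ofReal (Real.exp (t * |f x|)) ∂ρ ≤
      expMoment s ρ f 1 + ENNReal.ofReal (Real.exp (t ^ (s / (s - 1)))) := by
  have hs' : 0 < s - 1 := by linarith
  have : ∫⁻ _ : X, ENNReal.ofReal (Real.exp (t ^ (s / (s - 1)))) ∂ρ =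
      ENNReal.ofReal (Real.exp (t ^ (s / (s - 1)))) := by simp
  rw [← this]
  unfold expMoment
  rw [← lintegral_add_right _ measurable_const]
  refine lintegral_mono fun x => ?_
  rw [div_one]
  -- The threshold is the value of `|f|` at which `t |f| = |f| ^ s`.
  rcases le_total (t ^ (1 / (s - 1))) |f x| with h | h
  · refine le_trans (ENNReal.ofReal_le_ofReal (Real.exp_le_exp.2 ?_)) le_self_add
    have h0 : 0 < |f x| := (Real.rpow_pos_of_pos ht _).trans_le h
    have h1 := Real.rpow_le_rpow (by positivity) h hs'.le
    rw [← Real.rpow_mul ht.le, one_div_mul_cancel hs'.ne', Real.rpow_one] at h1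
    calc t * |f x| ≤ |f x| ^ (s - 1) * |f x| := by gcongr
      _ = |f x| ^ s := by
        rw [← Real.rpow_add_one h0.ne']; congr 1; ring
  · refine le_trans (ENNReal.ofReal_le_ofReal (Real.exp_le_exp.2 ?_)) le_add_self
    calc t * |f x| ≤ t * t ^ (1 / (s - 1)) := by gcongr
      _ = t ^ (s / (s - 1)) := by
        rw [mul_comm, ← Real.rpow_add_one ht.ne']; congr 1; field_simp; ring

end Hearts

/-! ### Entropic certainty equivalents and Gibbs expectations on one probability space. -/

section CertaintyEquivalent

variable {Z : Type*} [MeasurableSpace Z] {P : Measure Z} {k : ℝ} {Y Y' f g : Z → ℝ}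

/-- The entropic certainty equivalent `k⁻¹ log E[exp (k Y)]`, read as `E[Y]` when `k = 0`. -/
def certEq (k : ℝ) (P : Measure Z) (Y : Z → ℝ) : ℝ :=
  if k = 0 then ∫ z, Y z ∂P else k⁻¹ * Real.log (∫ z, Real.exp (k * Y z) ∂P)

/-- The expectation of `g` under the Gibbs change of measure with exponent `k Y`. -/
def gibbs (k : ℝ) (P : Measure Z) (Y g : Z → ℝ) : ℝ :=
  ∫ z, Real.exp (k * (Y z - certEq k P Y)) * g z ∂P

theorem certEq_congr (h : Y =ᵐ[P] Y') : certEq k P Y = certEq k P Y' := by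
  unfold certEq
  have h' : (fun z => Real.exp (k * Y z)) =ᵐ[P] fun z => Real.exp (k * Y' z) :=
    h.mono fun z hz => by simp only [hz]
  rw [integral_congr_ae h, integral_congr_ae h']

theorem gibbs_congr (h : Y =ᵐ[P] Y') (h' : f =ᵐ[P] g) : gibbs k P Y f = gibbs k P Y' g := by
  unfold gibbs
  rw [certEq_congr h]
  refine integral_congr_ae ?_
  filter_upwards [h, h'] with z h1 h2
  rw [h1, h2]

theorem gibbs_const_mul (a : ℝ) : gibbs k P Y (fun z => a * g z) = a * gibbs k P Y g := by
  unfold gibbs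
  rw [← integral_const_mul]
  congr with z
  ring

/-- Jensen's inequality for `exp` under a change of measure. -/
theorem exp_integral_mul_le {d : Z → ℝ} (hd : Integrable d P) (h0 : 0 ≤ᵐ[P] d)
    (h1 : ∫ z, d z ∂P = 1) (hf : Integrable (fun z => d z * f z) P)
    (he : Integrable (fun z => d z * Real.exp (f z)) P) :
    Real.exp (∫ z, d z * f z ∂P) ≤ ∫ z, d z * Real.exp (f z) ∂P := by
  set a := ∫ z, d z * f z ∂P with ha
  -- Integrate the tangent line of `exp` at the weighted mean `a` against the density `d`.
  have key : ∫ z, Real.exp a * (d z * f z + (1 - a) * d z) ∂P ≤ ∫ z, d z * Real.exp (f z) ∂P := by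
    refine integral_mono_ae ((hf.add (hd.const_mul _)).const_mul _) he ?_
    filter_upwards [h0] with z hz
    have h2 := Real.add_one_le_exp (f z - a)
    have h3 : Real.exp (f z) = Real.exp a * Real.exp (f z - a) := by
      rw [← Real.exp_add]; ring_nf
    rw [h3]
    have : Real.exp a * (d z * f z + (1 - a) * d z) = d z * (Real.exp a * (f z - a + 1)) := by ring
    simp only [this]
    exact mul_le_mul_of_nonneg_left (mul_le_mul_of_nonneg_left h2 (Real.exp_pos a).le) hz
  rw [integral_const_mul, integral_add hf (hd.const_mul _), integral_const_mul, h1, ← ha] at key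
  linarith

variable [IsProbabilityMeasure P]

theorem exp_mul_certEq (hk : k ≠ 0) (hY : MemOrliczHeart 1 P Y) :
    Real.exp (k * certEq k P Y) = ∫ z, Real.exp (k * Y z) ∂P := by
  unfold certEq
  rw [if_neg hk, mul_inv_cancel_left₀ hk]
  exact Real.exp_log (integral_exp_pos (hY.const_mul k).integrable_exp)

theorem memOrliczHeart_gibbs_exponent (hY : MemOrliczHeart 1 P Y) :
    MemOrliczHeart 1 P (fun z => k * (Y z - certEq k P Y)) :=
  (hY.sub le_rfl (.const _)).const_mul k

theorem integral_exp_gibbs (hY : MemOrliczHeart 1 P Y) :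
    ∫ z, Real.exp (k * (Y z - certEq k P Y)) ∂P = 1 := by
  by_cases hk : k = 0
  · simp [hk]
  have : ∀ z, Real.exp (k * (Y z - certEq k P Y)) =
      Real.exp (-(k * certEq k P Y)) * Real.exp (k * Y z) := fun z => by
    rw [← Real.exp_add]; ring_nf
  simp only [this]
  rw [integral_const_mul, ← exp_mul_certEq hk hY, ← Real.exp_add]
  simp

theorem certEq_const (a : ℝ) : certEq k P (fun _ => a) = a := by
  unfold certEq
  split_ifs with hk
  · simp
  · simp [hk]

theorem gibbs_const (hY : MemOrliczHeart 1 P Y) (a : ℝ) : gibbs k P Y (fun _ => a) = a := by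
  unfold gibbs
  rw [integral_mul_const, integral_exp_gibbs hY, one_mul]

theorem gibbs_add (hY : MemOrliczHeart 1 P Y) (hf : MemOrliczHeart 1 P f)
    (hg : MemOrliczHeart 1 P g) :
    gibbs k P Y (fun z => f z + g z) = gibbs k P Y f + gibbs k P Y g := by
  unfold gibbs
  have hL := memOrliczHeart_gibbs_exponent (k := k) hY
  rw [← integral_add (hL.integrable_exp_mul hf) (hL.integrable_exp_mul hg)]
  congr with z
  ring

theorem gibbs_mono (hY : MemOrliczHeart 1 P Y) (hf : MemOrliczHeart 1 P f)
    (hg : MemOrliczHeart 1 P g) (h : f ≤ᵐ[P] g) : gibbs k P Y f ≤ gibbs k P Y g := by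
  have hL := memOrliczHeart_gibbs_exponent (k := k) hY
  refine integral_mono_ae (hL.integrable_exp_mul hf) (hL.integrable_exp_mul hg) ?_
  filter_upwards [h] with z hz
  exact mul_le_mul_of_nonneg_left hz (Real.exp_pos _).le

theorem certEq_mono (hk : 0 ≤ k) (hY : MemOrliczHeart 1 P Y) (hY' : MemOrliczHeart 1 P Y')
    (h : Y ≤ᵐ[P] Y') : certEq k P Y ≤ certEq k P Y' := by
  unfold certEq
  split_ifs with hk0
  · exact integral_mono_ae hY.integrable hY'.integrable h
  · refine mul_le_mul_of_nonneg_left (Real.log_le_log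
      (integral_exp_pos (hY.const_mul k).integrable_exp)
      (integral_mono_ae (hY.const_mul k).integrable_exp (hY'.const_mul k).integrable_exp ?_))
      (by positivity)
    filter_upwards [h] with z hz
    exact Real.exp_le_exp.2 (mul_le_mul_of_nonneg_left hz hk)

/-- The Gibbs expectation is a subgradient of the certainty equivalent. -/
theorem certEq_add_gibbs_le (hk : 0 ≤ k) (hY : MemOrliczHeart 1 P Y)
    (hY' : MemOrliczHeart 1 P Y') :
    certEq k P Y + gibbs k P Y (fun z => Y' z - Y z) ≤ certEq k P Y' := by
  rcases hk.eq_or_lt with rfl | hk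
  · simp only [certEq, gibbs, zero_mul, Real.exp_zero, one_mul, if_true]
    rw [integral_sub hY'.integrable hY.integrable]
    linarith
  have hL := memOrliczHeart_gibbs_exponent (k := k) hY
  have hD := (hY'.sub le_rfl hY).const_mul k
  -- The subgradient inequality is Jensen's inequality under the Gibbs measure of `Y`, applied to `k
  -- (Y' - Y)`. The tilt by `Y` cancels, leaving the exponential of `k Y'` up to normalization.
  have e : ∀ z, Real.exp (k * (Y z - certEq k P Y)) * Real.exp (k * (Y' z - Y z)) =
      Real.exp (-(k * certEq k P Y)) * Real.exp (k * Y' z) := fun z => by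
    rw [← Real.exp_add, ← Real.exp_add]; ring_nf
  have h := exp_integral_mul_le hL.integrable_exp (ae_of_all _ fun z => (Real.exp_pos _).le)
    (integral_exp_gibbs hY) (hL.integrable_exp_mul hD)
    (by simp only [e]; exact (hY'.const_mul k).integrable_exp.const_mul _)
  simp only [e] at h
  rw [integral_const_mul, ← exp_mul_certEq hk.ne' hY', ← Real.exp_add, Real.exp_le_exp] at h
  change gibbs k P Y (fun z => k * (Y' z - Y z)) ≤ _ at h
  rw [gibbs_const_mul] at h
  nlinarith

/-- This is the subgradient inequality at the zero function, where the Gibbs weight equals one. -/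
theorem integral_le_certEq (hk : 0 ≤ k) (hY : MemOrliczHeart 1 P Y) :
    ∫ z, Y z ∂P ≤ certEq k P Y := by
  have h := certEq_add_gibbs_le hk (.const 0) hY
  rw [certEq_const] at h
  simpa [gibbs, certEq_const] using h

/-- Monotonicity bounds the positive side. The negative side needs the detour through means: `C(Y) ≥
E Y ≥ -E|Y| ≥ -C(|Y|)`. -/
theorem abs_certEq_le (hk : 0 ≤ k) (hY : MemOrliczHeart 1 P Y) :
    |certEq k P Y| ≤ certEq k P (fun z => |Y z|) := by
  refine abs_le.2 ⟨?_, certEq_mono hk hY hY.abs (ae_of_all _ fun z => le_abs_self _)⟩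
  have h1 := integral_le_certEq hk hY
  have h2 := integral_le_certEq hk hY.abs
  have h3 : -∫ z, |Y z| ∂P ≤ ∫ z, Y z ∂P := by
    rw [← integral_neg]
    exact integral_mono hY.abs.integrable.neg hY.integrable fun z => neg_abs_le _
  linarith

/-- Bernoulli's inequality, integrated. -/
theorem one_le_integral_exp_sub_certEq (hk : 0 ≤ k) {t : ℝ} (ht : k ≤ t)
    (hY : MemOrliczHeart 1 P Y) :
    1 ≤ ∫ z, Real.exp (t * (Y z - certEq k P Y)) ∂P := by
  have hD := hY.sub le_rfl (.const (certEq k P Y))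
  have hI := (hD.const_mul t).integrable_exp
  rcases hk.eq_or_lt with rfl | hk
  · calc (1 : ℝ) = ∫ z, (t * (Y z - certEq 0 P Y) + 1) ∂P := by
          rw [integral_add (hD.const_mul t).integrable (integrable_const _), integral_const_mul,
            integral_sub hY.integrable (integrable_const _)]
          simp [certEq]
      _ ≤ _ := integral_mono ((hD.const_mul t).integrable.add (integrable_const _)) hI
          fun z => Real.add_one_le_exp _
  · have hL := (hD.const_mul k).integrable_exp
    have hB : Integrable (fun z => t / k * (Real.exp (k * (Y z - certEq k P Y)) - 1)) P :=
      (hL.sub (integrable_const _)).const_mul _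
    calc (1 : ℝ) = ∫ z, (t / k * (Real.exp (k * (Y z - certEq k P Y)) - 1) + 1) ∂P := by
          rw [integral_add hB (integrable_const _),
            integral_const_mul, integral_sub hL (integrable_const _), integral_exp_gibbs hY]
          simp
      _ ≤ _ := by
          refine integral_mono (hB.add (integrable_const _)) hI fun z => ?_
          -- Bernoulli is applied to the power `t / k ≥ 1` of `exp (k (Y - C))`, a variable with
          -- mean one.
          have h1 : 1 ≤ t / k := (one_le_div hk).2 ht
          have h2 := one_add_mul_self_le_rpow_one_add
            (s := Real.exp (k * (Y z - certEq k P Y)) - 1)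
            (by linarith [Real.exp_pos (k * (Y z - certEq k P Y))]) h1
          rw [add_sub_cancel, ← Real.exp_mul] at h2
          have h3 : k * (Y z - certEq k P Y) * (t / k) = t * (Y z - certEq k P Y) := by
            field_simp
          rw [h3] at h2
          simp only
          linarith

/-- The certainty equivalent inherits the exponential moments of order `s` of its argument. -/
theorem ofReal_exp_abs_certEq_le (hk : 0 ≤ k) {s c : ℝ} (hs : 1 ≤ s) (hc : 0 < c)
    (hkc : k * c ≤ 1) (hY : MemOrliczHeart 1 P Y) :
    ENNReal.ofReal (Real.exp (|certEq k P Y / c| ^ s)) ≤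
      ENNReal.ofReal (Real.exp 1) + expMoment s P Y c := by
  set m := certEq k P (fun z => |Y z|) with hm
  have hle : |certEq k P Y / c| ≤ m / c := by
    rw [abs_div, abs_of_pos hc]
    exact div_le_div_of_nonneg_right (abs_certEq_le hk hY) hc.le
  -- Small values are absorbed by the constant `e`. For `m / c ≥ 1` the slope `t` below is at least
  -- `k`, as the integrated Bernoulli inequality requires; this is where `k * c ≤ 1` enters.
  rcases le_total (m / c) 1 with h1 | h1
  · refine le_trans (ENNReal.ofReal_le_ofReal (Real.exp_le_exp.2 ?_)) le_self_add
    exact Real.rpow_le_one (abs_nonneg _) (hle.trans h1) (by linarith)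
  refine le_trans ?_ le_add_self
  set a := m / c
  -- The slope at `m` of `y ↦ (y / c) ^ s`, so that `a ^ s + t (y - m)` is its tangent line there.
  set t := s * a ^ (s - 1) / c with ht
  have ht1 : k ≤ t := by
    have h2 : 1 ≤ a ^ (s - 1) := Real.one_le_rpow h1 (by linarith)
    have h3 : 1 ≤ s * a ^ (s - 1) := by nlinarith
    rw [ht, le_div_iff₀ hc]
    linarith
  have tangent : ∀ z, a ^ s + t * (|Y z| - m) ≤ |Y z / c| ^ s := by
    intro z
    have hb := one_add_mul_self_le_rpow_one_add (s := |Y z / c| / a - 1)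
      (by have : 0 ≤ |Y z / c| / a := by positivity
          linarith) hs
    have ha : 0 < a := by linarith
    rw [add_sub_cancel, Real.div_rpow (abs_nonneg _) ha.le,
      le_div_iff₀ (Real.rpow_pos_of_pos ha s)] at hb
    refine le_trans (le_of_eq ?_) hb
    have h4 : a ^ s = a ^ (s - 1) * a := by rw [← Real.rpow_add_one ha.ne']; ring_nf
    have h5 : m = a * c := by simp only [a]; field_simp
    rw [ht, abs_div, abs_of_pos hc, h4, h5]
    field_simp
  have hI := ((hY.abs.sub le_rfl (.const m)).const_mul t).integrable_exp
  calc ENNReal.ofReal (Real.exp (|certEq k P Y / c| ^ s))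
      ≤ ENNReal.ofReal (Real.exp (a ^ s)) :=
        ENNReal.ofReal_le_ofReal (Real.exp_le_exp.2
          (Real.rpow_le_rpow (abs_nonneg _) hle (by linarith)))
    _ ≤ ENNReal.ofReal (∫ z, Real.exp (a ^ s) * Real.exp (t * (|Y z| - m)) ∂P) := by
        refine ENNReal.ofReal_le_ofReal ?_
        rw [integral_const_mul]
        exact le_mul_of_one_le_right (Real.exp_pos _).le
          (one_le_integral_exp_sub_certEq hk ht1 hY.abs)
    _ = ∫⁻ z, ENNReal.ofReal (Real.exp (a ^ s) * Real.exp (t * (|Y z| - m))) ∂P :=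
        ofReal_integral_eq_lintegral_ofReal (hI.const_mul _) (ae_of_all _ fun z => by positivity)
    _ ≤ expMoment s P Y c := by
        refine lintegral_mono fun z => ENNReal.ofReal_le_ofReal ?_
        rw [← Real.exp_add]
        exact Real.exp_le_exp.2 (tangent z)

/-- Dominated convergence for certainty equivalents. -/
theorem tendsto_certEq {F : ℕ → Z → ℝ} {G : Z → ℝ} (hk : 0 ≤ k)
    (hF : ∀ n, AEMeasurable (F n) P)
    (hG : MemOrliczHeart 1 P G) (hFG : ∀ᵐ z ∂P, ∀ n, |F n z| ≤ G z) (hY : MemOrliczHeart 1 P Y)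
    (hlim : ∀ᵐ z ∂P, Tendsto (fun n => F n z) atTop (𝓝 (Y z))) :
    Tendsto (fun n => certEq k P (F n)) atTop (𝓝 (certEq k P Y)) := by
  unfold certEq
  split_ifs with hk0
  · exact tendsto_integral_of_dominated_convergence G (fun n => (hF n).aestronglyMeasurable)
      hG.integrable (fun n => hFG.mono fun z hz => hz n) hlim
  · refine Tendsto.const_mul _ (Tendsto.log ?_
      (integral_exp_pos (hY.const_mul k).integrable_exp).ne')
    refine tendsto_integral_of_dominated_convergence (fun z => Real.exp (k * G z))
      (fun n => by have := (hF n).aestronglyMeasurable; fun_prop)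
      (hG.const_mul k).integrable_exp (fun n => hFG.mono fun z hz => ?_)
      (hlim.mono fun z hz => ?_)
    · rw [Real.norm_of_nonneg (Real.exp_pos _).le]
      exact Real.exp_le_exp.2 (mul_le_mul_of_nonneg_left ((le_abs_self _).trans (hz n)) hk)
    · exact (Real.continuous_exp.tendsto _).comp (hz.const_mul k)

/-- Gibbs expectations inherit exponential moments, up to a loss in the exponent that can be traded
against moments of the density. -/
theorem ofReal_exp_abs_gibbs_le {ε : ℝ} (hε0 : 0 < ε) (hε1 : ε < 1)
    (hY : MemOrliczHeart 1 P Y) (hg : MemOrliczHeart 1 P g) :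
    ENNReal.ofReal (Real.exp ((1 - ε) * |gibbs k P Y g|)) ≤
      ∫⁻ z, (ENNReal.ofReal ε * ENNReal.ofReal
          (Real.exp (ε⁻¹ * |k * (Y z - certEq k P Y)|)) +
        ENNReal.ofReal (1 - ε) * ENNReal.ofReal (Real.exp |g z|)) ∂P := by
  have hε1' : 0 < 1 - ε := by linarith
  set L : Z → ℝ := fun z => k * (Y z - certEq k P Y) with hLdef
  have hL : MemOrliczHeart 1 P L := memOrliczHeart_gibbs_exponent hY
  have hg' := (hg.abs).const_mul (1 - ε)
  have hE : Integrable (fun z => Real.exp (L z) * Real.exp ((1 - ε) * |g z|)) P := by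
    simp only [← Real.exp_add]
    exact (hL.add le_rfl hg').integrable_exp
  have hB1 := (hL.integrable_exp_mul_abs (inv_pos.2 hε0)).const_mul ε
  have hB2 := (hg.abs.integrable_exp).const_mul (1 - ε)
  calc ENNReal.ofReal (Real.exp ((1 - ε) * |gibbs k P Y g|))
      ≤ ENNReal.ofReal (Real.exp (∫ z, Real.exp (L z) * ((1 - ε) * |g z|) ∂P)) := by
        refine ENNReal.ofReal_le_ofReal (Real.exp_le_exp.2 ?_)
        have : ∀ z, Real.exp (L z) * ((1 - ε) * |g z|) =
          (1 - ε) * (|Real.exp (L z) * g z|) := fun z => by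
          rw [abs_mul, abs_of_pos (Real.exp_pos _)]; ring
        simp only [this]
        rw [integral_const_mul]
        exact mul_le_mul_of_nonneg_left abs_integral_le_integral_abs hε1'.le
    _ ≤ ENNReal.ofReal (∫ z, Real.exp (L z) * Real.exp ((1 - ε) * |g z|) ∂P) :=
        ENNReal.ofReal_le_ofReal (exp_integral_mul_le hL.integrable_exp
          (ae_of_all _ fun z => (Real.exp_pos _).le) (integral_exp_gibbs hY)
          (hL.integrable_exp_mul hg') hE)
    _ ≤ ENNReal.ofReal (∫ z, (ε * Real.exp (ε⁻¹ * |L z|) + (1 - ε) * Real.exp |g z|) ∂P) := by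
        refine ENNReal.ofReal_le_ofReal (integral_mono hE (hB1.add hB2) fun z => ?_)
        -- Young's inequality: `L + (1 - ε)|g|` is the convex combination of `ε⁻¹ L` and `|g|` with
        -- weights `ε` and `1 - ε`.
        have h := convexOn_exp.2 (Set.mem_univ (ε⁻¹ * L z)) (Set.mem_univ (|g z|))
          hε0.le hε1'.le (by ring)
        simp only [smul_eq_mul, mul_inv_cancel_left₀ hε0.ne'] at h
        simp only [← Real.exp_add]
        refine h.trans ?_
        gcongr
        exact le_abs_self _
    _ = _ := by
        refine (ofReal_integral_eq_lintegral_ofReal (hB1.add hB2)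
          (ae_of_all _ fun z => add_nonneg (by positivity) (by positivity))).trans ?_
        refine lintegral_congr fun z => ?_
        simp only [Pi.add_apply]
        rw [ENNReal.ofReal_add (by positivity) (by positivity), ENNReal.ofReal_mul hε0.le,
          ENNReal.ofReal_mul hε1'.le]

end CertaintyEquivalent

/-! ### Conditional certainty equivalents and Gibbs expectations along a kernel. -/

section KernelLayer

variable {X Z : Type*} [MeasurableSpace X] [MeasurableSpace Z] {ρ : Measure X}
  {κ : Kernel X Z} {r s c k : ℝ} {Y g : X × Z → ℝ}

theorem measurable_certEq [IsSFiniteKernel κ] (hY : Measurable Y) :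
    Measurable (fun x => certEq k (κ x) (fun z => Y (x, z))) := by
  unfold certEq
  split_ifs with hk
  · exact (hY.stronglyMeasurable.integral_kernel_prod_right' (κ := κ)).measurable
  · have h : Measurable (fun p : X × Z => Real.exp (k * Y p)) := by fun_prop
    exact (Real.measurable_log.comp
      (h.stronglyMeasurable.integral_kernel_prod_right' (κ := κ)).measurable).const_mul _

theorem measurable_gibbs [IsSFiniteKernel κ] (hY : Measurable Y) (hg : Measurable g) :
    Measurable (fun x => gibbs k (κ x) (fun z => Y (x, z)) (fun z => g (x, z))) := by
  unfold gibbs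
  have h1 := measurable_certEq (κ := κ) (k := k) hY
  have h : Measurable (fun p : X × Z =>
      Real.exp (k * (Y p - certEq k (κ p.1) (fun z => Y (p.1, z)))) * g p) := by
    have : Measurable (fun p : X × Z => certEq k (κ p.1) (fun z => Y (p.1, z))) :=
      h1.comp measurable_fst
    fun_prop
  exact (h.stronglyMeasurable.integral_kernel_prod_right' (κ := κ)).measurable

variable [IsMarkovKernel κ] [IsProbabilityMeasure ρ]

theorem expMoment_compProd (hY : Measurable Y) :
    expMoment r (ρ ⊗ₘ κ) Y c = ∫⁻ x, expMoment r (κ x) (fun z => Y (x, z)) c ∂ρ := by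
  unfold expMoment
  rw [Measure.lintegral_compProd (by fun_prop)]

/-- Functions in the heart of a joint law have almost all sections in the heart of the conditional
law. -/
theorem MemOrliczHeart.ae_section (hr : 0 ≤ r) (hm : Measurable Y)
    (hY : MemOrliczHeart r (ρ ⊗ₘ κ) Y) :
    ∀ᵐ x ∂ρ, MemOrliczHeart r (κ x) (fun z => Y (x, z)) := by
  -- Moments decrease in the scale, so the countably many scales `1 / (n + 1)` suffice and yield a
  -- single null set.
  have h : ∀ n : ℕ, ∀ᵐ x ∂ρ,
      expMoment r (κ x) (fun z => Y (x, z)) (1 / ((n : ℝ) + 1)) < ∞ := by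
    intro n
    have h1 := hY.2 (1 / ((n : ℝ) + 1)) (by positivity)
    rw [expMoment_compProd hm] at h1
    refine ae_lt_top ?_ h1.ne
    unfold expMoment
    have : Measurable (fun p : X × Z =>
      ENNReal.ofReal (Real.exp (|Y p / (1 / ((n : ℝ) + 1))| ^ r))) := by fun_prop
    exact this.lintegral_kernel_prod_right'
  filter_upwards [ae_all_iff.2 h] with x hx
  refine ⟨(hm.comp measurable_prodMk_left).aemeasurable, fun c hc => ?_⟩
  obtain ⟨n, hn⟩ := exists_nat_one_div_lt hc
  exact (expMoment_anti hr (by positivity) hn.le).trans_lt (hx n)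

theorem expMoment_certEq_le (hk : 0 ≤ k) (hs : 1 ≤ s) (hc : 0 < c) (hkc : k * c ≤ 1)
    (hm : Measurable Y) (hY : MemOrliczHeart 1 (ρ ⊗ₘ κ) Y) :
    expMoment s ρ (fun x => certEq k (κ x) (fun z => Y (x, z))) c ≤
      ENNReal.ofReal (Real.exp 1) + expMoment s (ρ ⊗ₘ κ) Y c := by
  rw [expMoment_compProd hm]
  have : ∫⁻ _ : X, ENNReal.ofReal (Real.exp 1) ∂ρ = ENNReal.ofReal (Real.exp 1) := by simp
  rw [← this, ← lintegral_add_left measurable_const]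
  refine lintegral_mono_ae ?_
  filter_upwards [hY.ae_section zero_le_one hm] with x hx
  exact ofReal_exp_abs_certEq_le hk hs hc hkc hx

theorem MemOrliczHeart.certEq (hk : 0 ≤ k) (hs : 1 ≤ s)
    (hm : Measurable Y) (hY : MemOrliczHeart s (ρ ⊗ₘ κ) Y) :
    MemOrliczHeart s ρ (fun x => certEq k (κ x) (fun z => Y (x, z))) := by
  refine ⟨(measurable_certEq hm).aemeasurable, fun c hc => ?_⟩
  -- The moment bound needs `k * c ≤ 1`; larger scales follow because moments decrease in the scale.
  have hc' : 0 < min c (1 / (k + 1)) := by positivity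
  refine (expMoment_anti (by linarith) hc' (min_le_left _ _)).trans_lt ?_
  refine (expMoment_certEq_le hk hs hc' ?_ hm (hY.of_le zero_le_one hs)).trans_lt
    (ENNReal.add_lt_top.2 ⟨ENNReal.ofReal_lt_top, hY.2 _ hc'⟩)
  calc k * min c (1 / (k + 1)) ≤ k * (1 / (k + 1)) := by gcongr; exact min_le_right _ _
    _ ≤ 1 := by rw [mul_one_div, div_le_one (by positivity)]; linarith

/-- The log-density of the Gibbs change of measure. -/
theorem MemOrliczHeart.gibbs_exponent (hk : 0 ≤ k) (hs : 1 ≤ s)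
    (hm : Measurable Y) (hY : MemOrliczHeart s (ρ ⊗ₘ κ) Y) :
    MemOrliczHeart s (ρ ⊗ₘ κ)
      (fun p => k * (Y p - _root_.certEq k (κ p.1) (fun z => Y (p.1, z)))) := by
  refine (hY.sub hs ?_).const_mul k
  have h1 := hY.certEq hk hs hm
  have h2 : ρ = (ρ ⊗ₘ κ).map Prod.fst := by
    rw [← Measure.fst, Measure.fst_compProd]
  rw [h2] at h1
  exact h1.comp measurable_fst

/-- The bound for one measure, applied to `g / c` and integrated over `ρ`. Keeping `ε` free is
essential for the spectral radius: small `ε` means little loss in scale, paid for by high moments of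
the density. -/
theorem expMoment_gibbs_le {ε : ℝ} (hε0 : 0 < ε) (hε1 : ε < 1) (hc : 0 < c)
    (hm : Measurable Y) (hY : MemOrliczHeart 1 (ρ ⊗ₘ κ) Y)
    (hgm : Measurable g) (hg : MemOrliczHeart 1 (ρ ⊗ₘ κ) g) :
    expMoment 1 ρ (fun x => gibbs k (κ x) (fun z => Y (x, z)) (fun z => g (x, z)))
        (c / (1 - ε)) ≤
      ENNReal.ofReal ε * ∫⁻ p, ENNReal.ofReal (Real.exp (ε⁻¹ *
        |k * (Y p - certEq k (κ p.1) (fun z => Y (p.1, z)))|)) ∂(ρ ⊗ₘ κ) +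
      ENNReal.ofReal (1 - ε) * expMoment 1 (ρ ⊗ₘ κ) g c := by
  have hε1' : 0 < 1 - ε := by linarith
  have hce : Measurable (fun p : X × Z => certEq k (κ p.1) (fun z => Y (p.1, z))) :=
    (measurable_certEq (κ := κ) (k := k) hm).comp measurable_fst
  unfold expMoment
  rw [← lintegral_const_mul' _ _ ENNReal.ofReal_ne_top,
    ← lintegral_const_mul' _ _ ENNReal.ofReal_ne_top, ← lintegral_add_left (by fun_prop),
    Measure.lintegral_compProd (by fun_prop)]
  refine lintegral_mono_ae ?_
  filter_upwards [hY.ae_section zero_le_one hm, hg.ae_section zero_le_one hgm] with x hx hx'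
  have h := ofReal_exp_abs_gibbs_le (k := k) hε0 hε1 hx (hx'.const_mul c⁻¹)
  rw [gibbs_const_mul] at h
  simp only [Real.rpow_one, abs_div, abs_mul, abs_inv, abs_of_pos hc, abs_of_pos hε1',
    div_div_eq_mul_div] at h ⊢
  refine le_trans (le_of_eq ?_) (h.trans (le_of_eq ?_))
  · congr 2; ring
  · simp only [div_eq_inv_mul]

/-- The log-density has exponential moments of all orders, so the fixed choice `ε = 1 / 2` is enough
here. -/
theorem MemOrliczHeart.gibbs (hk : 0 ≤ k)
    (hm : Measurable Y) (hY : MemOrliczHeart 1 (ρ ⊗ₘ κ) Y)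
    (hgm : Measurable g) (hg : MemOrliczHeart 1 (ρ ⊗ₘ κ) g) :
    MemOrliczHeart 1 ρ
      (fun x => gibbs k (κ x) (fun z => Y (x, z)) (fun z => g (x, z))) := by
  refine ⟨(measurable_gibbs hm hgm).aemeasurable, fun c hc => ?_⟩
  have h := expMoment_gibbs_le (k := k) (ε := 1 / 2) (c := c / 2) (by norm_num) (by norm_num)
    (by positivity) hm hY hgm hg
  have e : c / 2 / (1 - 1 / 2) = c := by ring
  rw [e] at h
  refine h.trans_lt (ENNReal.add_lt_top.2 ⟨ENNReal.mul_lt_top ENNReal.ofReal_lt_top ?_,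
    ENNReal.mul_lt_top ENNReal.ofReal_lt_top (hg.2 _ (by positivity))⟩)
  have h2 := ((hY.gibbs_exponent hk le_rfl hm).integrable_exp_mul_abs
    (t := (1 / 2 : ℝ)⁻¹) (by norm_num)).2
  rwa [hasFiniteIntegral_iff_ofReal (ae_of_all _ fun x => by positivity)] at h2

end KernelLayer

/-! ### The recursion as nested certainty equivalents, under the stationary law. -/

namespace LearningModel

variable {S Φ B : Type*} [MeasurableSpace S] [MeasurableSpace Φ] [MeasurableSpace B]
  (M : LearningModel S Φ B)

/-- The joint law of `(ξ̂_t, ξ_t, φ_{t+1})` when `ξ̂_t` has law `ν`. -/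
def jointLaw (ν : Measure B) : Measure ((B × S) × Φ) :=
  (ν ⊗ₘ M.post) ⊗ₘ Kernel.prodMkLeft B M.obs

instance (ν : Measure B) [IsProbabilityMeasure ν] : IsProbabilityMeasure (M.jointLaw ν) := by
  unfold jointLaw; infer_instance

/-- The certainty equivalent of the continuation value given the hidden state. -/
def innerCertEq (k : ℝ) (U : Φ → ℝ) (f : B → ℝ) (b : B) (x : S) : ℝ :=
  certEq k (M.obs x) (fun y => f (M.upd b y) + U y)

/-- The recursion built from two nested certainty equivalents. -/
def recT (β k₁ k₂ : ℝ) (U : Φ → ℝ) (f : B → ℝ) (b : B) : ℝ :=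
  β * certEq k₂ (M.post b) (M.innerCertEq k₁ U f b)

/-- The Gibbs expectation of the continuation value given the hidden state. -/
def innerGibbs (k : ℝ) (U : Φ → ℝ) (v f : B → ℝ) (b : B) (x : S) : ℝ :=
  gibbs k (M.obs x) (fun y => v (M.upd b y) + U y) (fun y => f (M.upd b y))

/-- The subgradient of `recT`, built from two nested Gibbs expectations. -/
def recD (β k₁ k₂ : ℝ) (U : Φ → ℝ) (v f : B → ℝ) (b : B) : ℝ :=
  β * gibbs k₂ (M.post b) (M.innerCertEq k₁ U v b) (M.innerGibbs k₁ U v f b)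

theorem measurable_upd_joint : Measurable (fun p : (B × S) × Φ => M.upd p.1.1 p.2) :=
  M.measurable_upd.comp (f := fun p : (B × S) × Φ => (p.1.1, p.2)) (by fun_prop)

variable {M}

section Measurability

variable {k β k₁ k₂ : ℝ} {U : Φ → ℝ} {f v : B → ℝ}

theorem measurable_continuation (hU : Measurable U) (hf : Measurable f) :
    Measurable (fun p : (B × S) × Φ => f (M.upd p.1.1 p.2) + U p.2) :=
  (hf.comp M.measurable_upd_joint).add (hU.comp measurable_snd)

theorem measurable_innerCertEq (hU : Measurable U) (hf : Measurable f) :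
    Measurable (fun p : B × S => M.innerCertEq k U f p.1 p.2) :=
  measurable_certEq (κ := Kernel.prodMkLeft B M.obs) (k := k)
    (measurable_continuation (M := M) hU hf)

theorem measurable_recT (hU : Measurable U) (hf : Measurable f) :
    Measurable (M.recT β k₁ k₂ U f) :=
  (measurable_certEq (κ := M.post) (k := k₂)
    (measurable_innerCertEq (M := M) (k := k₁) hU hf)).const_mul β

theorem measurable_innerGibbs (hU : Measurable U) (hv : Measurable v) (hf : Measurable f) :
    Measurable (fun p : B × S => M.innerGibbs k U v f p.1 p.2) :=
  measurable_gibbs (κ := Kernel.prodMkLeft B M.obs) (k := k)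
    (measurable_continuation (M := M) hU hv) (hf.comp M.measurable_upd_joint)

end Measurability

variable {μ : Measure (Φ × B)} [IsProbabilityMeasure μ]

/-- The sole point where stationarity is unfolded. Its two marginals carry null sets and moments of
functions of `ξ̂_{t+1}` and `φ_{t+1}` back to `μ`. -/
theorem IsStationary.map_jointLaw (hμ : M.IsStationary μ) :
    (M.jointLaw μ.snd).map (fun p => (p.2, M.upd p.1.1 p.2)) = μ := by
  ext A hA
  have hmap : Measurable (fun p : (B × S) × Φ => (p.2, M.upd p.1.1 p.2)) :=
    measurable_snd.prodMk M.measurable_upd_joint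
  have hmap' : Measurable (fun p : B × Φ => (p.2, M.upd p.1 p.2)) :=
    measurable_snd.prodMk M.measurable_upd
  have htr : ∀ p, M.transition p A = ∫⁻ x, M.obs x {y | (y, M.upd p.2 y) ∈ A} ∂(M.post p.2) := by
    intro p
    rw [transition, Kernel.comap_apply, Kernel.map_apply' _ hmap' _ hA,
      Kernel.id_prod_apply' _ _ (hmap' hA), Kernel.comp_apply' _ _ _ (measurable_prodMk_left (hmap' hA))]
    rfl
  have hmeas : Measurable (fun p : B × S => M.obs p.2 {y | (y, M.upd p.1 y) ∈ A}) :=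
    Kernel.measurable_kernel_prodMk_left (κ := Kernel.prodMkLeft B M.obs) (hmap hA)
  conv_rhs => rw [← show μ.bind M.transition = μ from hμ]
  rw [Measure.bind_apply hA M.transition.measurable.aemeasurable, Measure.map_apply hmap hA,
    jointLaw, Measure.compProd_apply (hmap hA)]
  simp only [htr]
  rw [← lintegral_map (f := fun b => ∫⁻ x, M.obs x {y | (y, M.upd b y) ∈ A} ∂(M.post b))
    hmeas.lintegral_kernel_prod_right' measurable_snd]
  exact Measure.lintegral_compProd hmeas

theorem IsStationary.map_upd (hμ : M.IsStationary μ) :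
    (M.jointLaw μ.snd).map (fun p => M.upd p.1.1 p.2) = μ.snd :=
  (Measure.snd_map_prodMk measurable_snd).symm.trans (congrArg Measure.snd hμ.map_jointLaw)

theorem IsStationary.map_snd (hμ : M.IsStationary μ) :
    (M.jointLaw μ.snd).map Prod.snd = μ.fst :=
  (Measure.fst_map_prodMk M.measurable_upd_joint).symm.trans
    (congrArg Measure.fst hμ.map_jointLaw)

theorem ae_of_ae_jointLaw {ν : Measure B} [IsProbabilityMeasure ν] {p : (B × S) × Φ → Prop}
    (h : ∀ᵐ q ∂(M.jointLaw ν), p q) :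
    ∀ᵐ b ∂ν, ∀ᵐ x ∂(M.post b), ∀ᵐ y ∂(M.obs x), p ((b, x), y) :=
  Measure.ae_ae_of_ae_compProd (Measure.ae_ae_of_ae_compProd h)

theorem IsStationary.ae_jointLaw_upd (hμ : M.IsStationary μ) {p : B → Prop}
    (h : ∀ᵐ b ∂μ.snd, p b) : ∀ᵐ q ∂(M.jointLaw μ.snd), p (M.upd q.1.1 q.2) := by
  refine ae_of_ae_map M.measurable_upd_joint.aemeasurable ?_
  rw [hμ.map_upd]
  exact h

theorem IsStationary.ae_upd (hμ : M.IsStationary μ) {p : B → Prop} (h : ∀ᵐ b ∂μ.snd, p b) :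
    ∀ᵐ b ∂μ.snd, ∀ᵐ x ∂(M.post b), ∀ᵐ y ∂(M.obs x), p (M.upd b y) :=
  ae_of_ae_jointLaw (p := fun q => p (M.upd q.1.1 q.2)) (hμ.ae_jointLaw_upd h)

theorem IsStationary.ae_jointLaw_obs (hμ : M.IsStationary μ) {p : Φ → Prop}
    (h : ∀ᵐ y ∂μ.fst, p y) : ∀ᵐ q ∂(M.jointLaw μ.snd), p q.2 := by
  refine ae_of_ae_map measurable_snd.aemeasurable ?_
  rw [hμ.map_snd]
  exact h

theorem IsStationary.ae_obs (hμ : M.IsStationary μ) {p : Φ → Prop} (h : ∀ᵐ y ∂μ.fst, p y) :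
    ∀ᵐ b ∂μ.snd, ∀ᵐ x ∂(M.post b), ∀ᵐ y ∂(M.obs x), p y :=
  ae_of_ae_jointLaw (p := fun q => p q.2) (hμ.ae_jointLaw_obs h)

section Congruence

variable {k β k₁ k₂ : ℝ} {U U' : Φ → ℝ} {f f' v v' : B → ℝ}

theorem IsStationary.ae_innerCertEq_eq (hμ : M.IsStationary μ) (hU : U =ᵐ[μ.fst] U')
    (hf : f =ᵐ[μ.snd] f') :
    ∀ᵐ b ∂μ.snd, M.innerCertEq k U f b =ᵐ[M.post b] M.innerCertEq k U' f' b := by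
  filter_upwards [hμ.ae_upd hf, hμ.ae_obs hU] with b h1 h2
  filter_upwards [h1, h2] with x h1 h2
  exact certEq_congr (by filter_upwards [h1, h2] with y h1 h2; rw [h1, h2])

/-- Makes the recursion well defined on almost-everywhere classes, and lets later arguments pass to
measurable versions of payoffs and values. -/
theorem IsStationary.recT_congr (hμ : M.IsStationary μ) (hU : U =ᵐ[μ.fst] U')
    (hf : f =ᵐ[μ.snd] f') : M.recT β k₁ k₂ U f =ᵐ[μ.snd] M.recT β k₁ k₂ U' f' := by
  filter_upwards [hμ.ae_innerCertEq_eq hU hf] with b hb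
  rw [recT, recT, certEq_congr hb]

theorem IsStationary.ae_innerGibbs_eq (hμ : M.IsStationary μ) (hU : U =ᵐ[μ.fst] U')
    (hv : v =ᵐ[μ.snd] v') (hf : f =ᵐ[μ.snd] f') :
    ∀ᵐ b ∂μ.snd, M.innerGibbs k U v f b =ᵐ[M.post b] M.innerGibbs k U' v' f' b := by
  filter_upwards [hμ.ae_upd hf, hμ.ae_upd hv, hμ.ae_obs hU] with b h1 h2 h3
  filter_upwards [h1, h2, h3] with x h1 h2 h3
  exact gibbs_congr (by filter_upwards [h2, h3] with y h2 h3; rw [h2, h3]) h1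

theorem IsStationary.recD_congr (hμ : M.IsStationary μ) (hU : U =ᵐ[μ.fst] U')
    (hv : v =ᵐ[μ.snd] v') (hf : f =ᵐ[μ.snd] f') :
    M.recD β k₁ k₂ U v f =ᵐ[μ.snd] M.recD β k₁ k₂ U' v' f' := by
  filter_upwards [hμ.ae_innerCertEq_eq hU hv, hμ.ae_innerGibbs_eq hU hv hf] with b hb hb'
  rw [recD, recD, gibbs_congr hb hb']

end Congruence

/-! ### Invariance of the hearts and integrability of almost all sections. -/

section Integrability

variable {s c k β k₁ k₂ : ℝ} {U : Φ → ℝ} {f g v w : B → ℝ}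

theorem IsStationary.memOrliczHeart_upd (hμ : M.IsStationary μ) (hf : MemOrliczHeart s μ.snd f) :
    MemOrliczHeart s (M.jointLaw μ.snd) (fun p => f (M.upd p.1.1 p.2)) := by
  rw [← hμ.map_upd] at hf
  exact hf.comp M.measurable_upd_joint

theorem IsStationary.memOrliczHeart_obs (hμ : M.IsStationary μ) (hU : MemOrliczHeart s μ.fst U) :
    MemOrliczHeart s (M.jointLaw μ.snd) (fun p => U p.2) := by
  rw [← hμ.map_snd] at hU
  exact hU.comp measurable_snd

theorem IsStationary.memOrliczHeart_continuation (hμ : M.IsStationary μ) (hs : 1 ≤ s)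
    (hU : MemOrliczHeart s μ.fst U) (hf : MemOrliczHeart s μ.snd f) :
    MemOrliczHeart s (M.jointLaw μ.snd) (fun p => f (M.upd p.1.1 p.2) + U p.2) :=
  (hμ.memOrliczHeart_upd hf).add hs (hμ.memOrliczHeart_obs hU)

theorem IsStationary.memOrliczHeart_innerCertEq (hμ : M.IsStationary μ) (hk : 0 ≤ k) (hs : 1 ≤ s)
    (hUm : Measurable U) (hfm : Measurable f)
    (hU : MemOrliczHeart s μ.fst U) (hf : MemOrliczHeart s μ.snd f) :
    MemOrliczHeart s (μ.snd ⊗ₘ M.post) (fun p => M.innerCertEq k U f p.1 p.2) :=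
  (hμ.memOrliczHeart_continuation hs hU hf).certEq (κ := Kernel.prodMkLeft B M.obs) hk hs
    (measurable_continuation hUm hfm)

theorem IsStationary.memOrliczHeart_recT (hμ : M.IsStationary μ) (hk₁ : 0 ≤ k₁) (hk₂ : 0 ≤ k₂)
    (hs : 1 ≤ s) (hU : MemOrliczHeart s μ.fst U) (hf : MemOrliczHeart s μ.snd f) :
    MemOrliczHeart s μ.snd (M.recT β k₁ k₂ U f) := by
  have h := (hμ.memOrliczHeart_innerCertEq hk₁ hs hU.1.measurable_mk hf.1.measurable_mk
    (hU.congr hU.1.ae_eq_mk) (hf.congr hf.1.ae_eq_mk)).certEq hk₂ hs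
    (measurable_innerCertEq hU.1.measurable_mk hf.1.measurable_mk)
  exact (h.const_mul β).congr (hμ.recT_congr hU.1.ae_eq_mk hf.1.ae_eq_mk).symm

theorem IsStationary.memOrliczHeart_innerGibbs (hμ : M.IsStationary μ) (hk : 0 ≤ k)
    (hUm : Measurable U) (hvm : Measurable v) (hfm : Measurable f)
    (hU : MemOrliczHeart 1 μ.fst U) (hv : MemOrliczHeart 1 μ.snd v)
    (hf : MemOrliczHeart 1 μ.snd f) :
    MemOrliczHeart 1 (μ.snd ⊗ₘ M.post) (fun p => M.innerGibbs k U v f p.1 p.2) :=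
  MemOrliczHeart.gibbs (κ := Kernel.prodMkLeft B M.obs) hk
    (measurable_continuation hUm hvm) (hμ.memOrliczHeart_continuation le_rfl hU hv)
    (hfm.comp M.measurable_upd_joint) (hμ.memOrliczHeart_upd hf)

theorem IsStationary.memOrliczHeart_recD (hμ : M.IsStationary μ) (hk₁ : 0 ≤ k₁) (hk₂ : 0 ≤ k₂)
    (hU : MemOrliczHeart 1 μ.fst U) (hv : MemOrliczHeart 1 μ.snd v)
    (hf : MemOrliczHeart 1 μ.snd f) :
    MemOrliczHeart 1 μ.snd (M.recD β k₁ k₂ U v f) := by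
  have hU' := hU.congr hU.1.ae_eq_mk
  have hv' := hv.congr hv.1.ae_eq_mk
  have hf' := hf.congr hf.1.ae_eq_mk
  have h := MemOrliczHeart.gibbs hk₂
    (measurable_innerCertEq hU.1.measurable_mk hv.1.measurable_mk)
    (hμ.memOrliczHeart_innerCertEq hk₁ le_rfl hU.1.measurable_mk hv.1.measurable_mk hU' hv')
    (measurable_innerGibbs hU.1.measurable_mk hv.1.measurable_mk hf.1.measurable_mk)
    (hμ.memOrliczHeart_innerGibbs hk₁ hU.1.measurable_mk hv.1.measurable_mk hf.1.measurable_mk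
      hU' hv' hf')
  exact (h.const_mul β).congr (hμ.recD_congr hU.1.ae_eq_mk hv.1.ae_eq_mk hf.1.ae_eq_mk).symm

theorem IsStationary.ae_memOrliczHeart_upd (hμ : M.IsStationary μ)
    (hf : MemOrliczHeart 1 μ.snd f) :
    ∀ᵐ b ∂μ.snd, ∀ᵐ x ∂(M.post b), MemOrliczHeart 1 (M.obs x) (fun y => f (M.upd b y)) := by
  have h := (hμ.memOrliczHeart_upd (hf.congr hf.1.ae_eq_mk)).ae_section
    (κ := Kernel.prodMkLeft B M.obs) zero_le_one (hf.1.measurable_mk.comp M.measurable_upd_joint)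
  filter_upwards [hμ.ae_upd hf.1.ae_eq_mk, Measure.ae_ae_of_ae_compProd h] with b h1 h2
  filter_upwards [h1, h2] with x h1 h2
  have h3 : MemOrliczHeart 1 (M.obs x) (fun y => hf.1.mk f (M.upd b y)) := h2
  exact h3.congr (EventuallyEq.symm h1)

theorem IsStationary.ae_memOrliczHeart_obs (hμ : M.IsStationary μ)
    (hU : MemOrliczHeart 1 μ.fst U) :
    ∀ᵐ b ∂μ.snd, ∀ᵐ x ∂(M.post b), MemOrliczHeart 1 (M.obs x) U := by
  have h := (hμ.memOrliczHeart_obs (hU.congr hU.1.ae_eq_mk)).ae_section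
    (κ := Kernel.prodMkLeft B M.obs) zero_le_one (hU.1.measurable_mk.comp measurable_snd)
  filter_upwards [hμ.ae_obs hU.1.ae_eq_mk, Measure.ae_ae_of_ae_compProd h] with b h1 h2
  filter_upwards [h1, h2] with x h1 h2
  have h3 : MemOrliczHeart 1 (M.obs x) (hU.1.mk U) := h2
  exact h3.congr (EventuallyEq.symm h1)

theorem IsStationary.ae_memOrliczHeart_continuation (hμ : M.IsStationary μ)
    (hU : MemOrliczHeart 1 μ.fst U) (hf : MemOrliczHeart 1 μ.snd f) :
    ∀ᵐ b ∂μ.snd, ∀ᵐ x ∂(M.post b),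
      MemOrliczHeart 1 (M.obs x) (fun y => f (M.upd b y) + U y) := by
  filter_upwards [hμ.ae_memOrliczHeart_upd hf, hμ.ae_memOrliczHeart_obs hU] with b h1 h2
  filter_upwards [h1, h2] with x h1 h2
  exact h1.add le_rfl h2

theorem IsStationary.ae_memOrliczHeart_innerCertEq (hμ : M.IsStationary μ) (hk : 0 ≤ k)
    (hU : MemOrliczHeart 1 μ.fst U) (hf : MemOrliczHeart 1 μ.snd f) :
    ∀ᵐ b ∂μ.snd, MemOrliczHeart 1 (M.post b) (M.innerCertEq k U f b) := by
  have h := (hμ.memOrliczHeart_innerCertEq hk le_rfl hU.1.measurable_mk hf.1.measurable_mk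
    (hU.congr hU.1.ae_eq_mk) (hf.congr hf.1.ae_eq_mk)).ae_section zero_le_one
    (measurable_innerCertEq hU.1.measurable_mk hf.1.measurable_mk)
  filter_upwards [h, hμ.ae_innerCertEq_eq hU.1.ae_eq_mk hf.1.ae_eq_mk] with b h1 h2
  exact h1.congr h2.symm

theorem IsStationary.ae_memOrliczHeart_innerGibbs (hμ : M.IsStationary μ) (hk : 0 ≤ k)
    (hU : MemOrliczHeart 1 μ.fst U) (hv : MemOrliczHeart 1 μ.snd v)
    (hf : MemOrliczHeart 1 μ.snd f) :
    ∀ᵐ b ∂μ.snd, MemOrliczHeart 1 (M.post b) (M.innerGibbs k U v f b) := by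
  have h := (hμ.memOrliczHeart_innerGibbs hk hU.1.measurable_mk hv.1.measurable_mk
    hf.1.measurable_mk (hU.congr hU.1.ae_eq_mk) (hv.congr hv.1.ae_eq_mk)
    (hf.congr hf.1.ae_eq_mk)).ae_section zero_le_one
    (measurable_innerGibbs hU.1.measurable_mk hv.1.measurable_mk hf.1.measurable_mk)
  filter_upwards [h, hμ.ae_innerGibbs_eq hU.1.ae_eq_mk hv.1.ae_eq_mk hf.1.ae_eq_mk] with b h1 h2
  exact h1.congr h2.symm

end Integrability

/-! ### Monotonicity, linearity, the subgradient inequality and continuity. -/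

section Order

variable {s c k β k₁ k₂ : ℝ} {U : Φ → ℝ} {f g v w : B → ℝ}

theorem IsStationary.recT_mono (hμ : M.IsStationary μ) (hβ : 0 ≤ β) (hk₁ : 0 ≤ k₁) (hk₂ : 0 ≤ k₂)
    (hU : MemOrliczHeart 1 μ.fst U) (hf : MemOrliczHeart 1 μ.snd f)
    (hg : MemOrliczHeart 1 μ.snd g) (h : f ≤ᵐ[μ.snd] g) :
    M.recT β k₁ k₂ U f ≤ᵐ[μ.snd] M.recT β k₁ k₂ U g := by
  filter_upwards [hμ.ae_memOrliczHeart_innerCertEq hk₁ hU hf,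
    hμ.ae_memOrliczHeart_innerCertEq hk₁ hU hg, hμ.ae_memOrliczHeart_continuation hU hf,
    hμ.ae_memOrliczHeart_continuation hU hg, hμ.ae_upd h] with b h1 h2 h3 h4 h5
  refine mul_le_mul_of_nonneg_left (certEq_mono hk₂ h1 h2 ?_) hβ
  filter_upwards [h3, h4, h5] with x h3 h4 h5
  refine certEq_mono hk₁ h3 h4 ?_
  filter_upwards [h5] with y h5
  simpa using h5

/-- The recursion dominates its risk-neutral counterpart, for smaller flow payoffs. -/
theorem IsStationary.recT_zero_le (hμ : M.IsStationary μ) (hβ : 0 ≤ β) (hk₁ : 0 ≤ k₁)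
    (hk₂ : 0 ≤ k₂) {U' : Φ → ℝ} (hU : MemOrliczHeart 1 μ.fst U) (hU' : MemOrliczHeart 1 μ.fst U')
    (hUU' : ∀ y, U y ≤ U' y) (hf : MemOrliczHeart 1 μ.snd f) :
    M.recT β 0 0 U f ≤ᵐ[μ.snd] M.recT β k₁ k₂ U' f := by
  filter_upwards [hμ.ae_memOrliczHeart_innerCertEq le_rfl hU hf,
    hμ.ae_memOrliczHeart_innerCertEq hk₁ hU' hf, hμ.ae_memOrliczHeart_continuation hU hf,
    hμ.ae_memOrliczHeart_continuation hU' hf] with b h1 h2 h3 h4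
  refine mul_le_mul_of_nonneg_left (le_trans ?_ (integral_le_certEq hk₂ h2)) hβ
  simp only [certEq, if_true]
  refine integral_mono_ae h1.integrable h2.integrable ?_
  filter_upwards [h3, h4] with x h3 h4
  refine le_trans ?_ (integral_le_certEq hk₁ h4)
  simp only [innerCertEq, certEq, if_true]
  exact integral_mono h3.integrable h4.integrable fun y => by simpa using hUU' y

theorem IsStationary.recD_mono (hμ : M.IsStationary μ) (hβ : 0 ≤ β) (hk₁ : 0 ≤ k₁)
    (hU : MemOrliczHeart 1 μ.fst U) (hv : MemOrliczHeart 1 μ.snd v)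
    (hf : MemOrliczHeart 1 μ.snd f) (hg : MemOrliczHeart 1 μ.snd g) (h : f ≤ᵐ[μ.snd] g) :
    M.recD β k₁ k₂ U v f ≤ᵐ[μ.snd] M.recD β k₁ k₂ U v g := by
  filter_upwards [hμ.ae_memOrliczHeart_innerCertEq hk₁ hU hv,
    hμ.ae_memOrliczHeart_innerGibbs hk₁ hU hv hf, hμ.ae_memOrliczHeart_innerGibbs hk₁ hU hv hg,
    hμ.ae_memOrliczHeart_continuation hU hv, hμ.ae_memOrliczHeart_upd hf,
    hμ.ae_memOrliczHeart_upd hg, hμ.ae_upd h] with b h1 h2 h3 h4 h5 h6 h7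
  refine mul_le_mul_of_nonneg_left (gibbs_mono h1 h2 h3 ?_) hβ
  filter_upwards [h4, h5, h6, h7] with x h4 h5 h6 h7
  exact gibbs_mono h4 h5 h6 h7

theorem IsStationary.recD_add (hμ : M.IsStationary μ) (hk₁ : 0 ≤ k₁)
    (hU : MemOrliczHeart 1 μ.fst U) (hv : MemOrliczHeart 1 μ.snd v)
    (hf : MemOrliczHeart 1 μ.snd f) (hg : MemOrliczHeart 1 μ.snd g) :
    M.recD β k₁ k₂ U v (fun b => f b + g b) =ᵐ[μ.snd]
      fun b => M.recD β k₁ k₂ U v f b + M.recD β k₁ k₂ U v g b := by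
  filter_upwards [hμ.ae_memOrliczHeart_innerCertEq hk₁ hU hv,
    hμ.ae_memOrliczHeart_innerGibbs hk₁ hU hv hf, hμ.ae_memOrliczHeart_innerGibbs hk₁ hU hv hg,
    hμ.ae_memOrliczHeart_continuation hU hv, hμ.ae_memOrliczHeart_upd hf,
    hμ.ae_memOrliczHeart_upd hg] with b h1 h2 h3 h4 h5 h6
  rw [recD, recD, recD, ← mul_add, ← gibbs_add h1 h2 h3]
  congr 1
  refine gibbs_congr EventuallyEq.rfl ?_
  filter_upwards [h4, h5, h6] with x h4 h5 h6
  exact gibbs_add h4 h5 h6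

theorem recD_const_mul (a : ℝ) (b : B) :
    M.recD β k₁ k₂ U v (fun b => a * f b) b = a * M.recD β k₁ k₂ U v f b := by
  have h : M.innerGibbs k₁ U v (fun b => a * f b) b = fun x => a * M.innerGibbs k₁ U v f b x :=
    funext fun x => gibbs_const_mul a
  rw [recD, h, gibbs_const_mul, recD, mul_left_comm]

/-- Both Gibbs weights have total mass one. Constants are thus eigenfunctions for `β`, which bounds
the spectral radius from below. -/
theorem IsStationary.recD_const (hμ : M.IsStationary μ) (hk₁ : 0 ≤ k₁)
    (hU : MemOrliczHeart 1 μ.fst U) (hv : MemOrliczHeart 1 μ.snd v) (a : ℝ) :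
    M.recD β k₁ k₂ U v (fun _ => a) =ᵐ[μ.snd] fun _ => β * a := by
  filter_upwards [hμ.ae_memOrliczHeart_innerCertEq hk₁ hU hv,
    hμ.ae_memOrliczHeart_continuation hU hv] with b h1 h2
  rw [recD]
  congr 1
  refine (gibbs_congr EventuallyEq.rfl ?_).trans (gibbs_const h1 a)
  filter_upwards [h2] with x h2
  exact gibbs_const h2 a

/-- Use the subgradient inequality of the inner certainty equivalent, then positivity of the outer
Gibbs expectation, then the subgradient inequality of the outer certainty equivalent. -/
theorem IsStationary.recT_add_recD_le (hμ : M.IsStationary μ) (hβ : 0 ≤ β) (hk₁ : 0 ≤ k₁)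
    (hk₂ : 0 ≤ k₂) (hU : MemOrliczHeart 1 μ.fst U) (hv : MemOrliczHeart 1 μ.snd v)
    (hw : MemOrliczHeart 1 μ.snd w) :
    (fun b => M.recT β k₁ k₂ U v b + M.recD β k₁ k₂ U v (fun b => w b - v b) b) ≤ᵐ[μ.snd]
      M.recT β k₁ k₂ U w := by
  have hwv := hw.sub le_rfl hv
  filter_upwards [hμ.ae_memOrliczHeart_innerCertEq hk₁ hU hv,
    hμ.ae_memOrliczHeart_innerCertEq hk₁ hU hw,
    hμ.ae_memOrliczHeart_innerGibbs hk₁ hU hv hwv,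
    hμ.ae_memOrliczHeart_continuation hU hv, hμ.ae_memOrliczHeart_continuation hU hw]
    with b h1 h2 h3 h4 h5
  simp only [recT, recD, ← mul_add]
  refine mul_le_mul_of_nonneg_left (le_trans ?_ (certEq_add_gibbs_le hk₂ h1 h2)) hβ
  refine add_le_add_right (gibbs_mono h1 h3 (h2.sub le_rfl h1) ?_) _
  filter_upwards [h4, h5] with x h4 h5
  have h := certEq_add_gibbs_le hk₁ h4 h5
  simp only [add_sub_add_right_eq_sub] at h
  simp only [innerGibbs, innerCertEq]
  linarith

theorem IsStationary.tendsto_recT (hμ : M.IsStationary μ) (hk₁ : 0 ≤ k₁) (hk₂ : 0 ≤ k₂)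
    (hU : MemOrliczHeart 1 μ.fst U) {F : ℕ → B → ℝ} (hF : ∀ n, MemOrliczHeart 1 μ.snd (F n))
    (hf : MemOrliczHeart 1 μ.snd f) (hg : MemOrliczHeart 1 μ.snd g)
    (hFg : ∀ᵐ b ∂μ.snd, ∀ n, |F n b| ≤ g b)
    (hlim : ∀ᵐ b ∂μ.snd, Tendsto (fun n => F n b) atTop (𝓝 (f b))) :
    ∀ᵐ b ∂μ.snd, Tendsto (fun n => M.recT β k₁ k₂ U (F n) b) atTop
      (𝓝 (M.recT β k₁ k₂ U f b)) := by
  filter_upwards [hμ.ae_memOrliczHeart_innerCertEq hk₁ hU hf,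
    ae_all_iff.2 fun n => hμ.ae_memOrliczHeart_innerCertEq hk₁ hU (hF n),
    hμ.ae_memOrliczHeart_innerCertEq hk₁ hU.abs hg,
    hμ.ae_memOrliczHeart_continuation hU hf,
    ae_all_iff.2 fun n => hμ.ae_memOrliczHeart_continuation hU (hF n),
    hμ.ae_memOrliczHeart_continuation hU.abs hg, hμ.ae_upd hFg, hμ.ae_upd hlim]
    with b h1 h2 h3 h4 h5 h6 h7 h8
  -- Dominated convergence at both levels: the inner bound is `g + |U|`, and the outer one is the
  -- certainty equivalent of that bound.
  refine Tendsto.const_mul _ (tendsto_certEq hk₂ (fun n => (h2 n).1) h3 ?_ h1 ?_)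
  · filter_upwards [ae_all_iff.2 h5, h6, h7] with x h5 h6 h7 n
    refine (abs_certEq_le hk₁ (h5 n)).trans (certEq_mono hk₁ (h5 n).abs h6 ?_)
    filter_upwards [h7] with y h7
    exact (abs_add_le _ _).trans (add_le_add_left (h7 n) _)
  · filter_upwards [ae_all_iff.2 h5, h6, h7, h8, h4] with x h5 h6 h7 h8 h4
    refine tendsto_certEq hk₁ (fun n => (h5 n).1) h6 ?_ h4 ?_
    · filter_upwards [h7] with y h7 n
      exact (abs_add_le _ _).trans (add_le_add_left (h7 n) _)
    · filter_upwards [h8] with y h8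
      exact h8.add_const _

end Order

/-! ### Moment estimates along the recursion and its subgradient. -/

section Moments

variable {s c k β k₁ k₂ : ℝ} {U : Φ → ℝ} {f v : B → ℝ}

/-- Drift inequality for the exponential moments along the recursion. -/
theorem IsStationary.expMoment_recT_le (hμ : M.IsStationary μ) (hβ0 : 0 < β) (hβ1 : β < 1)
    (hk₁ : 0 ≤ k₁) (hk₂ : 0 ≤ k₂) (hs : 1 ≤ s) (hc : 0 < c) (h1 : k₁ * c ≤ 1) (h2 : k₂ * c ≤ 1)
    (hUm : Measurable U) (hfm : Measurable f) (hU : MemOrliczHeart 1 μ.fst U)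
    (hf : MemOrliczHeart 1 μ.snd f) :
    expMoment s μ.snd (M.recT β k₁ k₂ U f) (c * β) ≤
      ENNReal.ofReal (Real.exp 1) + (ENNReal.ofReal (Real.exp 1) +
        (ENNReal.ofReal β * expMoment s μ.snd f (c * β) +
          ENNReal.ofReal (1 - β) * expMoment s μ.fst U (c * (1 - β)))) := by
  have hce := hμ.memOrliczHeart_innerCertEq hk₁ le_rfl hUm hfm hU hf
  have step1 := expMoment_certEq_le hk₂ hs hc h2 (measurable_innerCertEq hUm hfm) hce
  have step2 := expMoment_certEq_le (κ := Kernel.prodMkLeft B M.obs) hk₁ hs hc h1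
    (measurable_continuation hUm hfm) (hμ.memOrliczHeart_continuation le_rfl hU hf)
  have step3 := expMoment_add_le (ρ := M.jointLaw μ.snd) (c := c) (g := fun p => U p.2) hs hβ0 hβ1
    (hfm.comp M.measurable_upd_joint).aemeasurable
  have e1 := expMoment_comp (r := s) (ρ := M.jointLaw μ.snd) (c := c * β) M.measurable_upd_joint
    (h := f) hfm.aemeasurable
  have e2 := expMoment_comp (r := s) (ρ := M.jointLaw μ.snd) (c := c * (1 - β)) measurable_snd
    (h := U) hUm.aemeasurable
  rw [hμ.map_upd] at e1
  rw [hμ.map_snd] at e2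
  rw [← e1, ← e2]
  -- The discount factor rescales `c` to `c * β`, exactly the scale at which convexity splits off
  -- `f`; hence the inequality can be iterated at one fixed scale.
  have e3 : expMoment s μ.snd (M.recT β k₁ k₂ U f) (c * β) = expMoment s μ.snd
      (fun b => certEq k₂ (M.post b) (fun x => M.innerCertEq k₁ U f b x)) c := by
    have := expMoment_const_mul (r := s) (ρ := μ.snd) (c := c * β) β
      (f := fun b => certEq k₂ (M.post b) (fun x => M.innerCertEq k₁ U f b x))
    rw [mul_div_cancel_right₀ _ hβ0.ne'] at this
    exact this
  rw [e3]
  exact step1.trans (add_le_add_right (step2.trans (add_le_add_right step3 _)) _)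

/-- The subgradient preserves bounds on exponential moments, up to a loss in the exponent that can
be traded against moments of the change of measure. -/
theorem IsStationary.expMoment_recD_le (hμ : M.IsStationary μ) (hβ0 : 0 < β)
    (hk₁ : 0 ≤ k₁) (hk₂ : 0 ≤ k₂) (hs : 1 < s) (hU : MemOrliczHeart s μ.fst U)
    (hv : MemOrliczHeart s μ.snd v) :
    ∃ C : ℝ≥0∞, C < ∞ ∧ ∀ ε : ℝ, 0 < ε → ε < 1 → ∀ c : ℝ, 0 < c → ∀ K : ℝ≥0∞,
      C + ENNReal.ofReal (Real.exp (ε⁻¹ ^ (s / (s - 1)))) ≤ K →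
      ∀ f, MemOrliczHeart 1 μ.snd f → expMoment 1 μ.snd f c ≤ K →
        expMoment 1 μ.snd (M.recD β k₁ k₂ U v f) (β * c / (1 - ε) ^ 2) ≤ K := by
  have hU' := hU.congr hU.1.ae_eq_mk
  have hv' := hv.congr hv.1.ae_eq_mk
  have hUm := hU.1.measurable_mk
  have hvm := hv.1.measurable_mk
  have mY := measurable_continuation (M := M) hUm hvm
  have mR := measurable_innerCertEq (M := M) (k := k₁) hUm hvm
  have hY := hμ.memOrliczHeart_continuation hs.le hU' hv'
  have hR := hμ.memOrliczHeart_innerCertEq hk₁ hs.le hUm hvm hU' hv'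
  have hL₁ := MemOrliczHeart.gibbs_exponent (κ := Kernel.prodMkLeft B M.obs) hk₁ hs.le mY hY
  have hL₂ := MemOrliczHeart.gibbs_exponent hk₂ hs.le mR hR
  -- `C` collects the moments of order `s` of the two log-densities. It depends on `U` and `v` but
  -- not on `ε`, which is what makes uniform bounds on iterates possible.
  refine ⟨_, ENNReal.add_lt_top.2 ⟨hL₁.2 1 one_pos, hL₂.2 1 one_pos⟩, ?_⟩
  intro ε hε0 hε1 c hc K hK f hf hfK
  have hε1' : 0 < 1 - ε := by linarith
  have hf' := hf.congr hf.1.ae_eq_mk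
  have hfm := hf.1.measurable_mk
  rw [expMoment_congr hf.1.ae_eq_mk] at hfK
  rw [expMoment_congr (hμ.recD_congr hU.1.ae_eq_mk hv.1.ae_eq_mk hf.1.ae_eq_mk)]
  have ht : 0 < ε⁻¹ := inv_pos.2 hε0
  have conv : ∀ a b : ℝ≥0∞, a ≤ K → b ≤ K →
      ENNReal.ofReal ε * a + ENNReal.ofReal (1 - ε) * b ≤ K := by
    intro a b ha hb
    calc _ ≤ ENNReal.ofReal ε * K + ENNReal.ofReal (1 - ε) * K := by gcongr
      _ = K := by
        rw [← add_mul, ← ENNReal.ofReal_add hε0.le hε1'.le]; simp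
  have hU1 := hU'.of_le zero_le_one hs.le
  have hv1 := hv'.of_le zero_le_one hs.le
  have step1 := expMoment_gibbs_le (κ := Kernel.prodMkLeft B M.obs) (k := k₁) hε0 hε1 hc mY
    (hY.of_le zero_le_one hs.le) (hfm.comp M.measurable_upd_joint) (hμ.memOrliczHeart_upd hf')
  have step2 := expMoment_gibbs_le (k := k₂) (c := c / (1 - ε)) hε0 hε1 (by positivity) mR
    (hR.of_le zero_le_one hs.le) (measurable_innerGibbs hUm hvm hfm)
    (hμ.memOrliczHeart_innerGibbs hk₁ hUm hvm hfm hU1 hv1 hf')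
  have e1 := expMoment_comp (r := 1) (ρ := M.jointLaw μ.snd) (c := c) M.measurable_upd_joint
    (h := hf.1.mk f) hfm.aemeasurable
  rw [hμ.map_upd] at e1
  -- The tail bound at `t = ε⁻¹` controls the density by `K`. Each of the two nested Gibbs
  -- expectations preserves `K` and costs one factor `1 - ε`.
  have bound1 := step1.trans (conv _ _
    (((lintegral_exp_mul_abs_le hs ht).trans (add_le_add_left le_self_add _)).trans hK)
    (e1.le.trans hfK))
  have bound2 := step2.trans (conv _ _
    (((lintegral_exp_mul_abs_le hs ht).trans (add_le_add_left le_add_self _)).trans hK) bound1)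
  refine le_trans (le_of_eq ?_) bound2
  have e := expMoment_const_mul (r := 1) (ρ := μ.snd) (c := β * c / (1 - ε) ^ 2) β
    (f := fun b => gibbs k₂ (M.post b) (fun x => M.innerCertEq k₁ (hU.1.mk U) (hv.1.mk v) b x)
      (fun x => M.innerGibbs k₁ (hU.1.mk U) (hv.1.mk v) (hf.1.mk f) b x))
  have e' : β * c / (1 - ε) ^ 2 / β = c / (1 - ε) / (1 - ε) := by field_simp
  rw [e'] at e
  exact e

end Moments

end LearningModel

/-! ### The Luxemburg norm and operator norms. -/

section LuxemburgNorm

variable {X : Type*} [MeasurableSpace X] {ρ : Measure X} {r c : ℝ} {f g : X → ℝ}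

theorem luxNorm_le_ofReal (hc : 0 < c) (h : expMoment r ρ f c ≤ 2) :
    luxNorm r ρ f ≤ ENNReal.ofReal c :=
  iInf_le_of_le c (iInf_le_of_le hc (iInf_le _ h))

theorem expMoment_le_two_of_luxNorm_lt (hr : 0 ≤ r) (h : luxNorm r ρ f < ENNReal.ofReal c) :
    expMoment r ρ f c ≤ 2 := by
  simp only [luxNorm, iInf_lt_iff] at h
  obtain ⟨c', h0, h1, h2⟩ := h
  exact (expMoment_anti hr h0 (ENNReal.ofReal_lt_ofReal_iff_of_nonneg h0.le |>.1 h2).le).trans h1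

theorem luxNorm_mono (hr : 0 ≤ r) (h : ∀ᵐ x ∂ρ, |f x| ≤ |g x|) :
    luxNorm r ρ f ≤ luxNorm r ρ g :=
  le_iInf fun _ => le_iInf fun hc => le_iInf fun hg =>
    luxNorm_le_ofReal hc ((expMoment_mono hr h).trans hg)

theorem luxNorm_congr (h : f =ᵐ[ρ] g) : luxNorm r ρ f = luxNorm r ρ g := by
  unfold luxNorm
  simp only [expMoment_congr h]

theorem luxNorm_const_mul_le {a : ℝ} (ha : 0 < a) :
    luxNorm r ρ (fun x => a * f x) ≤ ENNReal.ofReal a * luxNorm r ρ f := by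
  have ha' : ENNReal.ofReal a ≠ 0 := by simpa using ha
  rw [mul_comm, ← ENNReal.div_le_iff_le_mul (.inl ha') (.inl ENNReal.ofReal_ne_top)]
  refine le_iInf fun c => le_iInf fun hc => le_iInf fun hg => ?_
  rw [ENNReal.div_le_iff_le_mul (.inl ha') (.inl ENNReal.ofReal_ne_top), mul_comm,
    ← ENNReal.ofReal_mul ha.le]
  refine luxNorm_le_ofReal (by positivity) ?_
  rw [expMoment_const_mul, mul_div_cancel_left₀ _ ha.ne']
  exact hg

theorem luxNorm_const_mul {a : ℝ} (ha : 0 < a) :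
    luxNorm r ρ (fun x => a * f x) = ENNReal.ofReal a * luxNorm r ρ f := by
  refine le_antisymm (luxNorm_const_mul_le ha) ?_
  have h := luxNorm_const_mul_le (r := r) (ρ := ρ) (f := fun x => a * f x) (inv_pos.2 ha)
  simp only [inv_mul_cancel_left₀ ha.ne'] at h
  calc _ ≤ ENNReal.ofReal a * (ENNReal.ofReal a⁻¹ * luxNorm r ρ (fun x => a * f x)) := by gcongr
    _ = _ := by
      rw [← mul_assoc, ← ENNReal.ofReal_mul ha.le, mul_inv_cancel₀ ha.ne', ENNReal.ofReal_one,
        one_mul]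

/-- For every `n`, `n E|f| ≤ E exp(n|f|) ≤ 2`, which forces `E|f| = 0`. -/
theorem ae_eq_zero_of_luxNorm_eq_zero (hf : AEMeasurable f ρ) (h : luxNorm 1 ρ f = 0) :
    f =ᵐ[ρ] 0 := by
  have h1 : ∀ n : ℕ, (n : ℝ≥0∞) * ∫⁻ x, ENNReal.ofReal |f x| ∂ρ ≤ 2 := by
    intro n
    rcases Nat.eq_zero_or_pos n with rfl | hn
    · simp
    have hn' : (0 : ℝ) < n := by exact_mod_cast hn
    have h2 : expMoment 1 ρ f (n : ℝ)⁻¹ ≤ 2 :=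
      expMoment_le_two_of_luxNorm_lt zero_le_one (by rw [h]; simpa using hn)
    refine le_trans ?_ h2
    rw [← lintegral_const_mul' _ _ (ENNReal.natCast_ne_top n)]
    refine lintegral_mono fun x => ?_
    rw [← ENNReal.ofReal_natCast, ← ENNReal.ofReal_mul hn'.le, div_inv_eq_mul, Real.rpow_one,
      abs_mul, abs_of_pos hn']
    refine ENNReal.ofReal_le_ofReal ?_
    have := Real.add_one_le_exp (|f x| * n)
    linarith
  have h2 : ∫⁻ x, ENNReal.ofReal |f x| ∂ρ = 0 := by
    by_contra h0
    have h3 : Tendsto (fun n : ℕ => (n : ℝ≥0∞) * ∫⁻ x, ENNReal.ofReal |f x| ∂ρ) atTop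
        (𝓝 (∞ * ∫⁻ x, ENNReal.ofReal |f x| ∂ρ)) :=
      ENNReal.Tendsto.mul_const ENNReal.tendsto_nat_nhds_top (.inl ENNReal.top_ne_zero)
    rw [ENNReal.top_mul h0] at h3
    have := le_of_tendsto' h3 h1
    simp at this
  rw [lintegral_eq_zero_iff' (by fun_prop)] at h2
  filter_upwards [h2] with x hx
  simpa using hx

variable [IsProbabilityMeasure ρ]

/-- Jensen's inequality for the roots of exponential moments. -/
theorem expMoment_mul_le_two {k : ℝ} (hk : 1 ≤ k)
    (h : expMoment 1 ρ f c ≤ ENNReal.ofReal (2 ^ k)) : expMoment 1 ρ f (c * k) ≤ 2 := by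
  have hk0 : 0 < k := by linarith
  have hk1 : 0 ≤ 1 - k⁻¹ := by linarith [inv_le_one_of_one_le₀ hk]
  -- With `X = |f / c| - k log 2`, convexity gives `2 exp(X / k) ≤ 2 k⁻¹ exp X + 2 (1 - k⁻¹)`. `A`
  -- is the resulting coefficient of `exp |f / c|`, and integration yields exactly `2`.
  set A := 2 * k⁻¹ * (2 ^ k)⁻¹ with hA
  have hA0 : 0 ≤ A := by positivity
  calc expMoment 1 ρ f (c * k)
      ≤ ∫⁻ x, (ENNReal.ofReal A * ENNReal.ofReal (Real.exp (|f x / c| ^ (1 : ℝ))) +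
          ENNReal.ofReal (2 * (1 - k⁻¹))) ∂ρ := by
        refine lintegral_mono fun x => ?_
        rw [← ENNReal.ofReal_mul hA0, ← ENNReal.ofReal_add (by positivity) (by positivity)]
        refine ENNReal.ofReal_le_ofReal ?_
        rw [Real.rpow_one, Real.rpow_one]
        have h2 := convexOn_exp.2 (Set.mem_univ (|f x / c| - k * Real.log 2))
          (Set.mem_univ (0 : ℝ)) (inv_pos.2 hk0).le hk1 (by ring)
        simp only [smul_eq_mul, mul_zero, add_zero, Real.exp_zero, mul_one] at h2
        have e1 : |f x / (c * k)| = Real.log 2 + k⁻¹ * (|f x / c| - k * Real.log 2) := by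
          rw [← div_div, abs_div, abs_of_pos hk0]
          field_simp
          ring
        have e2 : Real.exp (|f x / c| - k * Real.log 2) =
            Real.exp |f x / c| * (2 ^ k)⁻¹ := by
          rw [Real.exp_sub, Real.rpow_def_of_pos (by norm_num), mul_comm k, div_eq_mul_inv]
        rw [e1, Real.exp_add, Real.exp_log (by norm_num), hA]
        rw [e2] at h2
        nlinarith
    _ = ENNReal.ofReal A * expMoment 1 ρ f c + ENNReal.ofReal (2 * (1 - k⁻¹)) := by
        rw [lintegral_add_right _ measurable_const, lintegral_const_mul' _ _ ENNReal.ofReal_ne_top]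
        simp [expMoment]
    _ ≤ ENNReal.ofReal A * ENNReal.ofReal (2 ^ k) + ENNReal.ofReal (2 * (1 - k⁻¹)) := by gcongr
    _ = 2 := by
        rw [← ENNReal.ofReal_mul hA0, ← ENNReal.ofReal_add (by positivity) (by positivity), hA,
          mul_assoc, inv_mul_cancel₀ (by positivity)]
        rw [show 2 * k⁻¹ * 1 + 2 * (1 - k⁻¹) = 2 by ring]
        simp

/-- A finite moment is at most `2 ^ k` for some `k ≥ 1`, and enlarging the scale by `k` brings it
down to `2`. -/
theorem MemOrliczHeart.luxNorm_lt_top (hf : MemOrliczHeart 1 ρ f) : luxNorm 1 ρ f < ∞ := by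
  have h := hf.2 1 one_pos
  set N := (expMoment 1 ρ f 1).toReal
  have hN : expMoment 1 ρ f 1 = ENNReal.ofReal N := (ENNReal.ofReal_toReal h.ne).symm
  obtain ⟨n, hn⟩ := pow_unbounded_of_one_lt N (one_lt_two (α := ℝ))
  have hle : expMoment 1 ρ f 1 ≤ ENNReal.ofReal (2 ^ ((n : ℝ) + 1)) := by
    rw [hN]
    refine ENNReal.ofReal_le_ofReal (hn.le.trans ?_)
    rw [← Real.rpow_natCast]
    exact Real.rpow_le_rpow_of_exponent_le one_le_two (by linarith)
  have h2 := expMoment_mul_le_two (by linarith [(Nat.cast_nonneg n : (0 : ℝ) ≤ n)]) hle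
  exact (luxNorm_le_ofReal (by positivity) h2).trans_lt ENNReal.ofReal_lt_top

theorem luxNorm_const {a : ℝ} (ha : 0 < a) :
    luxNorm 1 ρ (fun _ => a) = ENNReal.ofReal (a / Real.log 2) := by
  have hl : 0 < Real.log 2 := Real.log_pos one_lt_two
  have key : ∀ c : ℝ, 0 < c → (expMoment 1 ρ (fun _ => a) c ≤ 2 ↔ a / Real.log 2 ≤ c) := by
    intro c hc
    simp only [expMoment, lintegral_const, measure_univ, mul_one, Real.rpow_one]
    rw [abs_of_pos (by positivity), ← ENNReal.ofReal_ofNat, ENNReal.ofReal_le_ofReal_iff (by simp),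
      ← Real.le_log_iff_exp_le (by norm_num), div_le_comm₀ hc hl]
  refine le_antisymm (luxNorm_le_ofReal (by positivity) ((key _ (by positivity)).2 le_rfl)) ?_
  exact le_iInf fun c => le_iInf fun hc => le_iInf fun h =>
    ENNReal.ofReal_le_ofReal ((key c hc).1 h)

/-- Normalization to the unit sphere, with norm zero treated apart. Only homogeneity and
compatibility with null sets are assumed, so that it applies to iterates. -/
theorem luxNorm_le_heartOpNorm_mul {D : (X → ℝ) → X → ℝ}
    (hcongr : ∀ f g, MemOrliczHeart 1 ρ f → MemOrliczHeart 1 ρ g → f =ᵐ[ρ] g → D f =ᵐ[ρ] D g)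
    (hsmul : ∀ (a : ℝ) (f : X → ℝ), MemOrliczHeart 1 ρ f →
      D (fun x => a * f x) =ᵐ[ρ] fun x => a * D f x)
    (hf : MemOrliczHeart 1 ρ f) :
    luxNorm 1 ρ (D f) ≤ heartOpNorm 1 ρ D * luxNorm 1 ρ f := by
  rcases eq_or_ne (luxNorm 1 ρ f) 0 with h0 | h0
  · have hz := ae_eq_zero_of_luxNorm_eq_zero hf.1 h0
    have h1 : D f =ᵐ[ρ] D (fun x => 0 * f x) := by
      refine hcongr _ _ hf (hf.const_mul 0) ?_
      filter_upwards [hz] with x hx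
      simpa using hx
    have h2 : D f =ᵐ[ρ] f := by
      filter_upwards [h1, hsmul 0 f hf, hz] with x h1 h2 h3
      rw [h1, h2, h3]
      simp
    rw [luxNorm_congr h2, h0, mul_zero]
  set N := (luxNorm 1 ρ f).toReal
  have hN : luxNorm 1 ρ f = ENNReal.ofReal N := (ENNReal.ofReal_toReal hf.luxNorm_lt_top.ne).symm
  have hN0 : 0 < N := ENNReal.toReal_pos h0 hf.luxNorm_lt_top.ne
  have hg : luxNorm 1 ρ (fun x => N⁻¹ * f x) = 1 := by
    rw [luxNorm_const_mul (inv_pos.2 hN0), hN, ← ENNReal.ofReal_mul (inv_pos.2 hN0).le,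
      inv_mul_cancel₀ hN0.ne', ENNReal.ofReal_one]
  have h1 : luxNorm 1 ρ (D (fun x => N⁻¹ * f x)) ≤ heartOpNorm 1 ρ D :=
    le_iSup_of_le _ (le_iSup_of_le (hf.const_mul _) (le_iSup_of_le hg le_rfl))
  rw [luxNorm_congr (hsmul N⁻¹ f hf), luxNorm_const_mul (inv_pos.2 hN0)] at h1
  calc luxNorm 1 ρ (D f) = ENNReal.ofReal N * (ENNReal.ofReal N⁻¹ * luxNorm 1 ρ (D f)) := by
        rw [← mul_assoc, ← ENNReal.ofReal_mul hN0.le, mul_inv_cancel₀ hN0.ne', ENNReal.ofReal_one,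
          one_mul]
    _ ≤ ENNReal.ofReal N * heartOpNorm 1 ρ D := by gcongr
    _ = _ := by rw [hN, mul_comm]

end LuxemburgNorm

/-! ### Spectral radius of positive operators with controlled moments. -/

section SpectralRadius

variable {X : Type*} [MeasurableSpace X] {ρ : Measure X}
  {D : (X → ℝ) → X → ℝ}

theorem memOrliczHeart_iterate
    (hmap : ∀ f, MemOrliczHeart 1 ρ f → MemOrliczHeart 1 ρ (D f)) (n : ℕ) {f : X → ℝ}
    (hf : MemOrliczHeart 1 ρ f) : MemOrliczHeart 1 ρ (D^[n] f) := by
  induction n with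
  | zero => exact hf
  | succ n ih => rw [Function.iterate_succ_apply']; exact hmap _ ih

theorem IsBoundedLinearOnHeart.iterate_congr (hD : IsBoundedLinearOnHeart 1 ρ D) (n : ℕ)
    (f g : X → ℝ) (hf : MemOrliczHeart 1 ρ f) (hg : MemOrliczHeart 1 ρ g) (h : f =ᵐ[ρ] g) :
    D^[n] f =ᵐ[ρ] D^[n] g := by
  induction n with
  | zero => exact h
  | succ n ih =>
    rw [Function.iterate_succ_apply', Function.iterate_succ_apply']
    exact hD.congr _ _ (memOrliczHeart_iterate hD.mapsTo n hf)
      (memOrliczHeart_iterate hD.mapsTo n hg) ih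

variable [IsProbabilityMeasure ρ]

theorem IsBoundedLinearOnHeart.iterate_smul (hD : IsBoundedLinearOnHeart 1 ρ D) (n : ℕ)
    (a : ℝ) (f : X → ℝ) (hf : MemOrliczHeart 1 ρ f) :
    D^[n] (fun x => a * f x) =ᵐ[ρ] fun x => a * D^[n] f x := by
  induction n with
  | zero => exact EventuallyEq.rfl
  | succ n ih =>
    rw [Function.iterate_succ_apply', Function.iterate_succ_apply']
    have hn := memOrliczHeart_iterate hD.mapsTo n hf
    exact (hD.congr _ _ (memOrliczHeart_iterate hD.mapsTo n (hf.const_mul a)) (hn.const_mul a)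
      ih).trans (hD.smul a _ hn)

/-- A positive operator with spectral radius less than one has no positive subinvariant
function. -/
theorem IsBoundedLinearOnHeart.nonpos_of_le_apply (hD : IsBoundedLinearOnHeart 1 ρ D) {s : ℝ≥0∞}
    (hs : IsHeartSpectralRadius 1 ρ D s) (hs1 : s < 1)
    (hmono : ∀ f g, MemOrliczHeart 1 ρ f → MemOrliczHeart 1 ρ g → f ≤ᵐ[ρ] g → D f ≤ᵐ[ρ] D g)
    {g : X → ℝ} (hg : MemOrliczHeart 1 ρ g) (h : g ≤ᵐ[ρ] D g) : g ≤ᵐ[ρ] 0 := by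
  have hle : ∀ n, g ≤ᵐ[ρ] D^[n] g := by
    intro n
    induction n with
    | zero => exact EventuallyLE.rfl
    | succ n ih =>
      rw [Function.iterate_succ_apply']
      exact h.trans (hmono _ _ hg (memOrliczHeart_iterate hD.mapsTo n hg) ih)
  have hpos : MemOrliczHeart 1 ρ (fun x => max (g x) 0) :=
    hg.mono zero_le_one (hg.1.max aemeasurable_const) (ae_of_all _ fun x => by
      rw [abs_of_nonneg (le_max_right _ _)]
      exact max_le (le_abs_self _) (abs_nonneg _))
  -- Since `g ≤ D^n g`, the positive part of `g` is dominated by `|D^n g|`, whose norm tends to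
  -- zero.
  have hn : ∀ n, luxNorm 1 ρ (fun x => max (g x) 0) ≤ heartOpNorm 1 ρ D^[n] * luxNorm 1 ρ g := by
    intro n
    refine le_trans (luxNorm_mono zero_le_one ?_) (luxNorm_le_heartOpNorm_mul
      (hD.iterate_congr n) (hD.iterate_smul n) hg)
    filter_upwards [hle n] with x hx
    rw [abs_of_nonneg (le_max_right _ _)]
    exact max_le (hx.trans (le_abs_self _)) (abs_nonneg _)
  have h0 : Tendsto (fun n => heartOpNorm 1 ρ D^[n]) atTop (𝓝 0) := by
    obtain ⟨q, hq, hq1⟩ := exists_between hs1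
    have hev : ∀ᶠ n in atTop, heartOpNorm 1 ρ D^[n] ≤ q ^ n := by
      filter_upwards [hs.eventually (gt_mem_nhds hq), eventually_ge_atTop 1] with n hn h1
      have hn0 : (n : ℝ) ≠ 0 := by positivity
      rw [← ENNReal.rpow_natCast]
      calc heartOpNorm 1 ρ D^[n] = (heartOpNorm 1 ρ D^[n] ^ (1 / (n : ℝ))) ^ (n : ℝ) := by
            rw [← ENNReal.rpow_mul, one_div_mul_cancel hn0, ENNReal.rpow_one]
        _ ≤ q ^ (n : ℝ) := by gcongr
    exact tendsto_of_tendsto_of_tendsto_of_le_of_le' tendsto_const_nhds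
      (ENNReal.tendsto_pow_atTop_nhds_zero_of_lt_one hq1) (Eventually.of_forall fun _ => zero_le) hev
  have h1 := ENNReal.Tendsto.mul_const (b := luxNorm 1 ρ g) h0 (.inr hg.luxNorm_lt_top.ne)
  rw [zero_mul] at h1
  have h2 := le_antisymm (ge_of_tendsto' h1 hn) zero_le
  filter_upwards [ae_eq_zero_of_luxNorm_eq_zero hpos.1 h2] with x hx
  exact (le_max_left _ _).trans hx.le

/-- Polynomial bounds on the norms of iterates of an operator that preserves bounds on exponential
moments up to small losses in the exponent. -/
theorem heartOpNorm_iterate_le {β q : ℝ} {C : ℝ≥0∞} (hβ : 0 < β) (hq : 0 < q) (hC : C < ∞)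
    (hmap : ∀ f, MemOrliczHeart 1 ρ f → MemOrliczHeart 1 ρ (D f))
    (hmom : ∀ ε : ℝ, 0 < ε → ε < 1 → ∀ c : ℝ, 0 < c → ∀ K : ℝ≥0∞,
      C + ENNReal.ofReal (Real.exp (ε⁻¹ ^ q)) ≤ K →
      ∀ f, MemOrliczHeart 1 ρ f → expMoment 1 ρ f c ≤ K →
        expMoment 1 ρ (D f) (β * c / (1 - ε) ^ 2) ≤ K) :
    ∃ A : ℝ, 0 < A ∧ ∀ n : ℕ, 1 ≤ n →
      heartOpNorm 1 ρ D^[n] ≤ ENNReal.ofReal (β ^ n * (A * (n : ℝ) ^ q)) := by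
  have hl : 0 < Real.log 2 := Real.log_pos one_lt_two
  set C₀ := C.toReal
  have hC₀ : C = ENNReal.ofReal C₀ := (ENNReal.ofReal_toReal hC.ne).symm
  have hC0 : 0 ≤ C₀ := ENNReal.toReal_nonneg
  have hlogC : 0 < Real.log (C₀ + 3) := Real.log_pos (by linarith)
  refine ⟨4 * ((Real.log (C₀ + 3) + 4 ^ q) / Real.log 2), by positivity, fun n hn => ?_⟩
  have hn' : (1 : ℝ) ≤ n := by exact_mod_cast hn
  refine iSup_le fun f => iSup_le fun hf => iSup_le fun hf1 => ?_
  -- By Bernoulli the total loss over `n` steps satisfies `(1 - ε) ^ (2n) ≥ 1 - 2n / (4n) = 1 / 2`.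
  set ε : ℝ := (4 * (n : ℝ))⁻¹ with hε
  have hε0 : 0 < ε := by positivity
  have hε1 : ε < 1 := inv_lt_one_of_one_lt₀ (by linarith)
  have hε1' : 0 < 1 - ε := by linarith
  set E := Real.exp ((4 * (n : ℝ)) ^ q) with hE
  have hE1 : 1 ≤ E := Real.one_le_exp (by positivity)
  set K : ℝ≥0∞ := ENNReal.ofReal (C₀ + E + 2) with hK
  have hK1 : C + ENNReal.ofReal (Real.exp (ε⁻¹ ^ q)) ≤ K := by
    rw [hε, inv_inv, hC₀, ← ENNReal.ofReal_add hC0 (by positivity)]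
    exact ENNReal.ofReal_le_ofReal (by linarith)
  -- Scale `2` rather than `1` gives a strict inequality with the norm, so the infimum need not be
  -- attained.
  have hf2 : expMoment 1 ρ f 2 ≤ K := by
    refine (expMoment_le_two_of_luxNorm_lt zero_le_one (by rw [hf1]; simp)).trans ?_
    rw [← ENNReal.ofReal_ofNat]
    exact ENNReal.ofReal_le_ofReal (by linarith)
  have hiter : ∀ m : ℕ, expMoment 1 ρ (D^[m] f) (2 * (β / (1 - ε) ^ 2) ^ m) ≤ K := by
    intro m
    induction m with
    | zero => simpa using hf2
    | succ m ih =>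
      rw [Function.iterate_succ_apply']
      have h := hmom ε hε0 hε1 _ (by positivity) K hK1 _ (memOrliczHeart_iterate hmap m hf) ih
      convert h using 2
      ring
  have hbern : 1 / 2 ≤ ((1 - ε) ^ 2) ^ n := by
    rw [← pow_mul, sub_eq_add_neg]
    refine le_trans (le_of_eq ?_) (one_add_mul_le_pow (by linarith) (2 * n))
    push_cast
    rw [hε]
    field_simp
    norm_num
  have h4 : expMoment 1 ρ (D^[n] f) (4 * β ^ n) ≤ K := by
    refine (expMoment_anti zero_le_one (by positivity) ?_).trans (hiter n)
    rw [div_pow, ← mul_div_assoc, div_le_iff₀ (by positivity)]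
    nlinarith [pow_pos hβ n]
  -- Chosen so that `2 ^ k = (C₀ + 3) E`, which dominates `C₀ + E + 2` because `E ≥ 1`. Its growth
  -- in `n` is that of `n ^ q`.
  set k := (Real.log (C₀ + 3) + (4 * (n : ℝ)) ^ q) / Real.log 2 with hk
  have hk1 : 1 ≤ k := by
    rw [hk, le_div_iff₀ hl, one_mul]
    have : Real.log 2 ≤ Real.log (C₀ + 3) := Real.log_le_log two_pos (by linarith)
    have : 0 ≤ (4 * (n : ℝ)) ^ q := by positivity
    linarith
  have h2k : C₀ + E + 2 ≤ 2 ^ k := by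
    rw [Real.rpow_def_of_pos two_pos, hk, mul_div_cancel₀ _ hl.ne', Real.exp_add,
      Real.exp_log (by linarith), ← hE]
    nlinarith
  refine (luxNorm_le_ofReal (by positivity) (expMoment_mul_le_two hk1
    (h4.trans (ENNReal.ofReal_le_ofReal h2k)))).trans (ENNReal.ofReal_le_ofReal ?_)
  have hkle : k ≤ (Real.log (C₀ + 3) + 4 ^ q) / Real.log 2 * (n : ℝ) ^ q := by
    rw [hk, Real.mul_rpow (by norm_num) (by positivity), div_mul_eq_mul_div]
    have : 1 ≤ (n : ℝ) ^ q := Real.one_le_rpow hn' hq.le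
    refine div_le_div_of_nonneg_right ?_ hl.le
    nlinarith
  calc 4 * β ^ n * k
      ≤ 4 * β ^ n * ((Real.log (C₀ + 3) + 4 ^ q) / Real.log 2 * (n : ℝ) ^ q) := by gcongr
    _ = _ := by ring

/-- The constant `log 2` has norm one and eigenvalue `β`, giving `‖D^n‖ ≥ β ^ n`; the polynomial
factor in the upper bound disappears under the `n`-th root. -/
theorem isHeartSpectralRadius_of_bounds {β q A : ℝ} (hβ : 0 < β) (hA : 0 < A)
    (hD : IsBoundedLinearOnHeart 1 ρ D)
    (hconst : ∀ a : ℝ, D (fun _ => a) =ᵐ[ρ] fun _ => β * a)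
    (hup : ∀ n : ℕ, 1 ≤ n →
      heartOpNorm 1 ρ D^[n] ≤ ENNReal.ofReal (β ^ n * (A * (n : ℝ) ^ q))) :
    IsHeartSpectralRadius 1 ρ D (ENNReal.ofReal β) := by
  have hl : 0 < Real.log 2 := Real.log_pos one_lt_two
  have hiter : ∀ n : ℕ, D^[n] (fun _ => Real.log 2) =ᵐ[ρ] fun _ => β ^ n * Real.log 2 := by
    intro n
    induction n with
    | zero => simp
    | succ n ih =>
      rw [Function.iterate_succ_apply']
      refine (hD.congr _ _ (memOrliczHeart_iterate hD.mapsTo n (.const _)) (.const _) ih).trans ?_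
      filter_upwards [hconst (β ^ n * Real.log 2)] with x hx
      rw [hx, pow_succ']
      ring
  have hlow : ∀ n : ℕ, ENNReal.ofReal (β ^ n) ≤ heartOpNorm 1 ρ D^[n] := by
    intro n
    have h1 : luxNorm 1 ρ (fun _ => Real.log 2) = 1 := by
      rw [luxNorm_const hl, div_self hl.ne', ENNReal.ofReal_one]
    refine le_trans (le_of_eq ?_)
      (le_iSup_of_le (fun _ => Real.log 2) (le_iSup_of_le (.const _) (le_iSup_of_le h1 le_rfl)))
    rw [luxNorm_congr (hiter n), luxNorm_const (by positivity), mul_div_cancel_right₀ _ hl.ne']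
  refine tendsto_of_tendsto_of_tendsto_of_le_of_le'
    (h := fun n : ℕ => ENNReal.ofReal (β * (A ^ (1 / (n : ℝ)) * ((n : ℝ) ^ (1 / (n : ℝ))) ^ q)))
    tendsto_const_nhds ?_ ?_ ?_
  · refine ENNReal.tendsto_ofReal ?_
    have h1 : Tendsto (fun n : ℕ => A ^ (1 / (n : ℝ))) atTop (𝓝 1) := by
      have := (Real.continuousAt_const_rpow (b := 0) hA.ne').tendsto.comp
        (tendsto_one_div_atTop_nhds_zero_nat (𝕜 := ℝ))
      simpa [Function.comp_def] using this
    have h2 : Tendsto (fun n : ℕ => ((n : ℝ) ^ (1 / (n : ℝ))) ^ q) atTop (𝓝 1) := by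
      have := (tendsto_rpow_div.comp tendsto_natCast_atTop_atTop).rpow_const (p := q)
        (.inl one_ne_zero)
      simpa [Function.comp_def] using this
    simpa using (h1.mul h2).const_mul β
  · filter_upwards [eventually_ge_atTop 1] with n hn
    have hn0 : (n : ℝ) ≠ 0 := by positivity
    calc ENNReal.ofReal β = ENNReal.ofReal (β ^ n) ^ (1 / (n : ℝ)) := by
          rw [ENNReal.ofReal_rpow_of_pos (by positivity), ← Real.rpow_natCast,
            ← Real.rpow_mul hβ.le, mul_one_div_cancel hn0, Real.rpow_one]
      _ ≤ _ := by gcongr; exact hlow n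
  · filter_upwards [eventually_ge_atTop 1] with n hn
    have hn0 : (n : ℝ) ≠ 0 := by positivity
    have hn1 : 0 < (n : ℝ) := by positivity
    calc heartOpNorm 1 ρ D^[n] ^ (1 / (n : ℝ))
        ≤ ENNReal.ofReal (β ^ n * (A * (n : ℝ) ^ q)) ^ (1 / (n : ℝ)) := by gcongr; exact hup n hn
      _ = _ := by
        rw [ENNReal.ofReal_rpow_of_pos (by positivity), Real.mul_rpow (by positivity)
          (by positivity), Real.mul_rpow hA.le (by positivity), ← Real.rpow_natCast,
          ← Real.rpow_mul hβ.le, mul_one_div_cancel hn0, Real.rpow_one, ← Real.rpow_mul hn1.le,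
          ← Real.rpow_mul hn1.le, mul_comm q]

end SpectralRadius

/-! ### Limits of sequences with bounded exponential moments, by Fatou's lemma. -/

section MonotoneLimits

variable {X : Type*} [MeasurableSpace X] {ρ : Measure X} {r c : ℝ} {F : ℕ → X → ℝ}

theorem expMoment_le_of_tendsto (hr : 0 ≤ r) {f : X → ℝ} (hF : ∀ n, Measurable (F n))
    (hlim : ∀ᵐ x ∂ρ, Tendsto (fun n => F n x) atTop (𝓝 (f x))) {K : ℝ≥0∞}
    (hK : ∀ n, expMoment r ρ (F n) c ≤ K) : expMoment r ρ f c ≤ K := by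
  calc expMoment r ρ f c
      = ∫⁻ x, liminf (fun n => ENNReal.ofReal (Real.exp (|F n x / c| ^ r))) atTop ∂ρ := by
        refine lintegral_congr_ae ?_
        filter_upwards [hlim] with x hx
        have : Tendsto (fun n => ENNReal.ofReal (Real.exp (|F n x / c| ^ r))) atTop
            (𝓝 (ENNReal.ofReal (Real.exp (|f x / c| ^ r)))) :=
          ENNReal.tendsto_ofReal ((Real.continuous_exp.tendsto _).comp
            ((hx.div_const c).abs.rpow_const (.inr hr)))
        exact this.liminf_eq.symm
    _ ≤ liminf (fun n => expMoment r ρ (F n) c) atTop :=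
        lintegral_liminf_le fun n => by have := hF n; fun_prop
    _ ≤ K := liminf_le_of_le (by isBoundedDefault) fun b hb => by
        obtain ⟨n, hn⟩ := hb.exists
        exact hn.trans (hK n)

/-- Increasing sequences with bounded exponential moments converge. -/
theorem ae_tendsto_of_monotone_of_expMoment_le (hr : 0 < r) (hc : 0 < c)
    (hF : ∀ n, Measurable (F n)) (hmono : ∀ᵐ x ∂ρ, Monotone fun n => F n x) {K : ℝ≥0∞}
    (hKtop : K < ∞) (hK : ∀ n, expMoment r ρ (F n) c ≤ K) :
    ∀ᵐ x ∂ρ, Tendsto (fun n => F n x) atTop (𝓝 (⨆ n, F n x)) := by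
  have hfin : ∀ᵐ x ∂ρ, liminf (fun n => ENNReal.ofReal (Real.exp (|F n x / c| ^ r))) atTop < ∞ := by
    have hm : ∀ n, Measurable fun x => ENNReal.ofReal (Real.exp (|F n x / c| ^ r)) := fun n => by
      have := hF n
      fun_prop
    refine ae_lt_top (.liminf hm) (ne_of_lt ?_)
    refine (lintegral_liminf_le hm).trans_lt (lt_of_le_of_lt ?_ hKtop)
    exact liminf_le_of_le (by isBoundedDefault) fun b hb => by
      obtain ⟨n, hn⟩ := hb.exists
      exact hn.trans (hK n)
  filter_upwards [hfin, hmono] with x hx hm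
  rcases tendsto_atTop_of_monotone hm with h | ⟨l, hl⟩
  · have h1 : Tendsto (fun n => ENNReal.ofReal (Real.exp (|F n x / c| ^ r))) atTop (𝓝 ∞) :=
      ENNReal.tendsto_ofReal_nhds_top.2 (Real.tendsto_exp_atTop.comp
        ((tendsto_rpow_atTop hr).comp (tendsto_abs_atTop_atTop.comp (h.atTop_div_const hc))))
    rw [h1.liminf_eq] at hx
    exact absurd hx (lt_irrefl _)
  · exact tendsto_atTop_ciSup hm ⟨l, by rintro _ ⟨n, rfl⟩; exact hm.ge_of_tendsto hl n⟩

end MonotoneLimits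

/-! ### Stability, the least fixed point, and comparison of fixed points. -/

namespace LearningModel

variable {S Φ B : Type*} [MeasurableSpace S] [MeasurableSpace Φ] [MeasurableSpace B]
  {M : LearningModel S Φ B} {μ : Measure (Φ × B)} [IsProbabilityMeasure μ]
  {r s β k₁ k₂ : ℝ} {U : Φ → ℝ}

theorem IsStationary.isBoundedLinearOnHeart_recD (hμ : M.IsStationary μ) (hk₁ : 0 ≤ k₁)
    (hk₂ : 0 ≤ k₂) (hU : MemOrliczHeart 1 μ.fst U) {v : B → ℝ} (hv : MemOrliczHeart 1 μ.snd v)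
    (hb : heartOpNorm 1 μ.snd (M.recD β k₁ k₂ U v) < ∞) :
    IsBoundedLinearOnHeart 1 μ.snd (M.recD β k₁ k₂ U v) where
  mapsTo _ hf := hμ.memOrliczHeart_recD hk₁ hk₂ hU hv hf
  congr _ _ _ _ h := hμ.recD_congr .rfl .rfl h
  add _ _ hf hg := hμ.recD_add hk₁ hU hv hf hg
  smul a _ _ := ae_of_all _ (recD_const_mul a)
  bounded := hb

/-- At points of a heart of order `s > 1` the subgradient is a bounded operator on the heart of
order one, with spectral radius `β`. -/
theorem IsStationary.recD_stable (hμ : M.IsStationary μ) (hβ : 0 < β) (hk₁ : 0 ≤ k₁)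
    (hk₂ : 0 ≤ k₂) (hs : 1 < s) (hU : MemOrliczHeart s μ.fst U) {v : B → ℝ}
    (hv : MemOrliczHeart s μ.snd v) :
    IsBoundedLinearOnHeart 1 μ.snd (M.recD β k₁ k₂ U v) ∧
      IsHeartSpectralRadius 1 μ.snd (M.recD β k₁ k₂ U v) (ENNReal.ofReal β) := by
  have hU1 := hU.of_le zero_le_one hs.le
  have hv1 := hv.of_le zero_le_one hs.le
  obtain ⟨C, hC, hmom⟩ := hμ.expMoment_recD_le hβ hk₁ hk₂ hs hU hv
  obtain ⟨A, hA, hup⟩ := heartOpNorm_iterate_le hβ (div_pos (by linarith) (by linarith)) hC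
    (fun f hf => hμ.memOrliczHeart_recD hk₁ hk₂ hU1 hv1 hf) hmom
  have hb := hμ.isBoundedLinearOnHeart_recD hk₁ hk₂ hU1 hv1
    ((hup 1 le_rfl).trans_lt ENNReal.ofReal_lt_top)
  exact ⟨hb, isHeartSpectralRadius_of_bounds hβ hA hb (hμ.recD_const hk₁ hU1 hv1) hup⟩

/-- Monotone iteration from a subsolution produces the smallest supersolution above it. -/
theorem IsStationary.exists_fixedPoint_of_subsolution (hμ : M.IsStationary μ) (hβ0 : 0 < β)
    (hβ1 : β < 1) (hk₁ : 0 ≤ k₁) (hk₂ : 0 ≤ k₂) (hr : 1 ≤ r) (hUm : Measurable U)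
    (hU : MemOrliczHeart r μ.fst U) {v₀ : B → ℝ} (hv₀m : Measurable v₀)
    (hv₀ : MemOrliczHeart r μ.snd v₀) (hsub : v₀ ≤ᵐ[μ.snd] M.recT β k₁ k₂ U v₀) :
    ∃ v : B → ℝ, Measurable v ∧ MemOrliczHeart r μ.snd v ∧ M.recT β k₁ k₂ U v =ᵐ[μ.snd] v ∧
      v₀ ≤ᵐ[μ.snd] v ∧ ∀ f, MemOrliczHeart 1 μ.snd f → M.recT β k₁ k₂ U f ≤ᵐ[μ.snd] f →
        v₀ ≤ᵐ[μ.snd] f → v ≤ᵐ[μ.snd] f := by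
  have hU1 := hU.of_le zero_le_one hr
  set F : ℕ → B → ℝ := fun n => (M.recT β k₁ k₂ U)^[n] v₀ with hFdef
  have hFs : ∀ n, F (n + 1) = M.recT β k₁ k₂ U (F n) := fun n =>
    Function.iterate_succ_apply' _ _ _
  have hFm : ∀ n, Measurable (F n) := by
    intro n
    induction n with
    | zero => exact hv₀m
    | succ n ih => rw [hFs]; exact measurable_recT hUm ih
  have hFr : ∀ n, MemOrliczHeart r μ.snd (F n) := by
    intro n
    induction n with
    | zero => exact hv₀
    | succ n ih => rw [hFs]; exact hμ.memOrliczHeart_recT hk₁ hk₂ hr hU ih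
  have hF1 := fun n => (hFr n).of_le zero_le_one hr
  have hFstep : ∀ n, F n ≤ᵐ[μ.snd] F (n + 1) := by
    intro n
    induction n with
    | zero => exact hsub
    | succ n ih =>
      rw [hFs, hFs (n + 1)]
      exact hμ.recT_mono hβ0.le hk₁ hk₂ hU1 (hF1 _) (hF1 _) ih
  have hFmono : ∀ᵐ b ∂μ.snd, Monotone fun n => F n b := by
    filter_upwards [ae_all_iff.2 hFstep] with b hb
    exact monotone_nat_of_le_succ hb
  have hbound : ∀ c : ℝ, 0 < c → k₁ * c ≤ 1 → k₂ * c ≤ 1 →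
      ∃ K : ℝ≥0∞, K < ∞ ∧ ∀ n, expMoment r μ.snd (F n) (c * β) ≤ K := by
    intro c hc h1 h2
    set p := ENNReal.ofReal (1 - β) with hp
    have hp0 : p ≠ 0 := by simpa [hp] using hβ1
    set A := ENNReal.ofReal (Real.exp 1) + (ENNReal.ofReal (Real.exp 1) +
      p * expMoment r μ.fst U (c * (1 - β))) with hA
    have hAtop : A < ∞ := by
      refine ENNReal.add_lt_top.2 ⟨ENNReal.ofReal_lt_top, ENNReal.add_lt_top.2
        ⟨ENNReal.ofReal_lt_top, ENNReal.mul_lt_top ENNReal.ofReal_lt_top (hU.2 _ ?_)⟩⟩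
      have : 0 < 1 - β := by linarith
      positivity
    -- The drift map `x ↦ A + β x` has fixed point `A / (1 - β)`; adding the initial moment makes
    -- the bound hold at step zero and preserves `A + β K ≤ K`.
    refine ⟨A / p + expMoment r μ.snd v₀ (c * β), ENNReal.add_lt_top.2
      ⟨ENNReal.div_lt_top hAtop.ne hp0, hv₀.2 _ (by positivity)⟩, fun n => ?_⟩
    set K := A / p + expMoment r μ.snd v₀ (c * β) with hK
    induction n with
    | zero => exact le_add_self
    | succ n ih =>
      rw [hFs]
      refine (hμ.expMoment_recT_le hβ0 hβ1 hk₁ hk₂ hr hc h1 h2 hUm (hFm n) hU1 (hF1 n)).trans ?_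
      calc _ = A + ENNReal.ofReal β * expMoment r μ.snd (F n) (c * β) := by rw [hA]; ring
        _ ≤ p * K + ENNReal.ofReal β * K := by
          gcongr
          calc A = p * (A / p) := (ENNReal.mul_div_cancel hp0 ENNReal.ofReal_ne_top).symm
            _ ≤ p * K := by gcongr; exact le_self_add
        _ = K := by
          rw [← add_mul, hp, ← ENNReal.ofReal_add (by linarith) hβ0.le]
          simp
  set c₀ : ℝ := (1 + k₁ + k₂)⁻¹ with hc₀
  have hc₀pos : 0 < c₀ := by positivity
  have hc₀le : ∀ c, c ≤ c₀ → k₁ * c ≤ 1 ∧ k₂ * c ≤ 1 := by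
    intro c hc
    have h : (1 + k₁ + k₂) * c₀ = 1 := mul_inv_cancel₀ (by positivity)
    constructor <;> nlinarith
  obtain ⟨K₀, hK₀, hb₀⟩ := hbound c₀ hc₀pos (hc₀le _ le_rfl).1 (hc₀le _ le_rfl).2
  have hlim := ae_tendsto_of_monotone_of_expMoment_le (by linarith) (by positivity) hFm hFmono
    hK₀ hb₀
  set v : B → ℝ := fun b => ⨆ n, F n b with hv
  have hvm : Measurable v := .iSup hFm
  have hvr : MemOrliczHeart r μ.snd v := by
    refine ⟨hvm.aemeasurable, fun c hc => ?_⟩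
    -- Almost sure convergence needed one scale only; membership in the heart needs arbitrarily
    -- small ones, and the drift bound is available at all of them.
    obtain ⟨h1, h2⟩ := hc₀le (min c c₀) (min_le_right _ _)
    obtain ⟨K, hK, hb⟩ := hbound (min c c₀) (by positivity) h1 h2
    refine (expMoment_anti (by linarith) (by positivity) ?_).trans_lt
      ((expMoment_le_of_tendsto (by linarith) hFm hlim hb).trans_lt hK)
    have : min c c₀ ≤ c := min_le_left _ _
    nlinarith
  have hv1 := hvr.of_le zero_le_one hr
  have hFv : ∀ᵐ b ∂μ.snd, ∀ n, F n b ≤ v b := by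
    filter_upwards [hlim, hFmono] with b h1 h2 n
    exact h2.ge_of_tendsto h1 n
  refine ⟨v, hvm, hvr, ?_, hFv.mono fun b hb => hb 0, ?_⟩
  · have hdom : ∀ᵐ b ∂μ.snd, ∀ n, |F n b| ≤ |v₀ b| + |v b| := by
      filter_upwards [hFv, hFmono] with b h1 h2 n
      have h3 : v₀ b ≤ F n b := h2 (Nat.zero_le n)
      rw [abs_le]
      constructor
      · linarith [neg_abs_le (v₀ b), abs_nonneg (v b)]
      · linarith [h1 n, le_abs_self (v b), abs_nonneg (v₀ b)]
    have hT := hμ.tendsto_recT (β := β) hk₁ hk₂ hU1 hF1 hv1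
      ((hF1 0).abs.add le_rfl hv1.abs) hdom hlim
    filter_upwards [hT, hlim] with b h1 h2
    simp only [← hFs] at h1
    exact tendsto_nhds_unique h1 ((tendsto_add_atTop_iff_nat 1).2 h2)
  · intro f hf hTf hle
    have hFf : ∀ n, F n ≤ᵐ[μ.snd] f := by
      intro n
      induction n with
      | zero => exact hle
      | succ n ih =>
        rw [hFs]
        exact (hμ.recT_mono hβ0.le hk₁ hk₂ hU1 (hF1 n) hf ih).trans hTf
    filter_upwards [ae_all_iff.2 hFf, hlim] with b h1 h2
    exact le_of_tendsto' h2 h1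

/-- Expectations are odd, so a solution with payoff `|U|` turns into a solution with payoff `-|U|`.
-/
theorem recT_zero_neg (f : B → ℝ) (b : B) :
    M.recT β 0 0 (fun y => -U y) (fun b => -f b) b = -M.recT β 0 0 U f b := by
  simp only [recT, innerCertEq, certEq, if_true, ← neg_add, integral_neg, mul_neg]

/-- The smallest supersolution in the heart of order one is a fixed point, and it inherits the
integrability of the flow payoff. -/
theorem IsStationary.exists_least_fixedPoint (hμ : M.IsStationary μ) (hβ0 : 0 < β)
    (hβ1 : β < 1) (hk₁ : 0 ≤ k₁) (hk₂ : 0 ≤ k₂) (hr : 1 ≤ r) (hUm : Measurable U)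
    (hU : MemOrliczHeart r μ.fst U) :
    ∃ v : B → ℝ, Measurable v ∧ MemOrliczHeart r μ.snd v ∧ M.recT β k₁ k₂ U v =ᵐ[μ.snd] v ∧
      ∀ f, MemOrliczHeart 1 μ.snd f → M.recT β k₁ k₂ U f ≤ᵐ[μ.snd] f → v ≤ᵐ[μ.snd] f := by
  have hU1 := hU.of_le zero_le_one hr
  have hnn : (fun _ => (0 : ℝ)) ≤ᵐ[μ.snd] M.recT β 0 0 (fun y => |U y|) (fun _ => 0) := by
    refine ae_of_all _ fun b => ?_
    simp only [recT, innerCertEq, certEq, if_true, zero_add]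
    exact mul_nonneg hβ0.le (integral_nonneg fun x => integral_nonneg fun y => abs_nonneg _)
  obtain ⟨w, hwm, hw, hTw, -, -⟩ := hμ.exists_fixedPoint_of_subsolution hβ0 hβ1 le_rfl le_rfl hr
    hUm.abs hU.abs measurable_const (.const 0) hnn
  have hw1 := hw.of_le zero_le_one hr
  have hTw' : M.recT β 0 0 (fun y => -|U y|) (fun b => -w b) =ᵐ[μ.snd] fun b => -w b := by
    filter_upwards [hTw] with b hb
    rw [recT_zero_neg, hb]
  have hsub : (fun b => -w b) ≤ᵐ[μ.snd] M.recT β k₁ k₂ U (fun b => -w b) :=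
    hTw'.symm.le.trans (hμ.recT_zero_le hβ0.le hk₁ hk₂ hU1.abs.neg hU1
      (fun y => neg_abs_le _) hw1.neg)
  obtain ⟨v, hvm, hv, hTv, -, hmin⟩ := hμ.exists_fixedPoint_of_subsolution hβ0 hβ1 hk₁ hk₂ hr
    hUm hU hwm.neg hw.neg hsub
  refine ⟨v, hvm, hv, hTv, fun f hf hTf => hmin f hf hTf ?_⟩
  have hlow := hμ.recT_zero_le (β := β) hβ0.le hk₁ hk₂ hU1.abs.neg hU1
    (fun y => neg_abs_le _) hf
  have hg := hw1.neg.sub le_rfl hf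
  -- With `k₁ = k₂ = 0` the Gibbs weights are one and the subgradient does not depend on payoff or
  -- base point (`hlin`). It may be studied at zero, which lies in every heart, so any order above
  -- one serves; `2` is arbitrary. This covers `r = 1` as well.
  obtain ⟨hD, hρ⟩ := hμ.recD_stable hβ0 le_rfl le_rfl (s := 2) one_lt_two
    (MemOrliczHeart.const 0) (MemOrliczHeart.const 0)
  have hlin : ∀ g, M.recD β 0 0 (fun y => -|U y|) (fun b => -w b) g =
      M.recD β 0 0 (fun _ => 0) (fun _ => 0) g := by
    intro g
    funext b
    simp [recD, innerGibbs, gibbs]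
  -- A supersolution `f` is also one for the risk-neutral recursion with payoff `-|U|`, which `-w`
  -- solves; comparing the two makes `-w - f` subinvariant.
  have hle : (fun b => -w b - f b) ≤ᵐ[μ.snd]
      M.recD β 0 0 (fun _ => 0) (fun _ => 0) (fun b => -w b - f b) := by
    have hgrad := hμ.recT_add_recD_le hβ0.le le_rfl le_rfl hU1.abs.neg hw1.neg hf
    rw [hlin] at hgrad
    filter_upwards [hgrad, hTw', hlow, hTf] with b h1 h2 h3 h4
    have h5 := recD_const_mul (M := M) (β := β) (k₁ := 0) (k₂ := 0) (U := fun _ => 0)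
      (v := fun _ => 0) (f := fun b => -w b - f b) (-1) b
    have h6 : (fun b => -1 * (-w b - f b)) = fun b => f b - -w b := by
      funext b
      ring
    rw [h6] at h5
    rw [h5, h2] at h1
    linarith
  have := hD.nonpos_of_le_apply hρ (by simpa using hβ1)
    (fun f g hf hg h => hμ.recD_mono hβ0.le le_rfl (.const 0) (.const 0) hf hg h) hg hle
  filter_upwards [this] with b hb
  simpa using hb

/-- A stable fixed point lies below every other fixed point. -/
theorem IsStationary.le_of_stable (hμ : M.IsStationary μ) (hβ0 : 0 < β)
    (hk₁ : 0 ≤ k₁) (hk₂ : 0 ≤ k₂) (hU : MemOrliczHeart 1 μ.fst U) {v w : B → ℝ}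
    (hv : MemOrliczHeart 1 μ.snd v) (hw : MemOrliczHeart 1 μ.snd w)
    (hTv : M.recT β k₁ k₂ U v =ᵐ[μ.snd] v) (hTw : M.recT β k₁ k₂ U w =ᵐ[μ.snd] w)
    (hD : IsBoundedLinearOnHeart 1 μ.snd (M.recD β k₁ k₂ U w)) {ρ : ℝ≥0∞}
    (hρ : IsHeartSpectralRadius 1 μ.snd (M.recD β k₁ k₂ U w) ρ) (hρ1 : ρ < 1) :
    w ≤ᵐ[μ.snd] v := by
  have hle : (fun b => w b - v b) ≤ᵐ[μ.snd] M.recD β k₁ k₂ U w (fun b => w b - v b) := by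
    filter_upwards [hμ.recT_add_recD_le hβ0.le hk₁ hk₂ hU hw hv, hTv, hTw] with b h1 h2 h3
    have h5 := recD_const_mul (M := M) (β := β) (k₁ := k₁) (k₂ := k₂) (U := U)
      (v := w) (f := fun b => w b - v b) (-1) b
    have h6 : (fun b => -1 * (w b - v b)) = fun b => v b - w b := by
      funext b
      ring
    rw [h6] at h5
    rw [h5, h2, h3] at h1
    linarith
  filter_upwards [hD.nonpos_of_le_apply hρ hρ1
    (fun f g hf hg h => hμ.recD_mono hβ0.le hk₁ hU hw hf hg h) (hw.sub le_rfl hv) hle] with b hb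
  simpa using hb

end LearningModel

/-! ### Translation between the original operators and the nested form. -/

namespace LearningModel

variable {S Φ B : Type*} [MeasurableSpace S] [MeasurableSpace Φ] [MeasurableSpace B]
  {M : LearningModel S Φ B} {θ α β : ℝ} {ϑ : ℝ≥0∞} {u : Φ → ℝ} {f v : B → ℝ} {b : B} {x : S}

/-- The coefficient of the flow payoff when the recursion is written with certainty equivalents. -/
def payoffCoeff (θ : ℝ) (ϑ : ℝ≥0∞) (α : ℝ) : ℝ :=
  if ϑ = ∞ then α else α * (ϑ.toReal / θ)

theorem innerIntegrand_of_ne_top (hθ : 0 < θ) (hϑ : 0 < ϑ) (h : ϑ ≠ ∞) (y : Φ) :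
    M.innerIntegrand θ ϑ α u f b y =
      Real.exp (θ / ϑ.toReal * (f (M.upd b y) + payoffCoeff θ ϑ α * u y)) := by
  have hϑ' := ENNReal.toReal_pos hϑ.ne' h
  rw [innerIntegrand, if_neg h, payoffCoeff, if_neg h]
  congr 1
  field_simp

theorem integrable_innerIntegrand (hθ : 0 < θ) (hϑ : 0 < ϑ)
    (hY : MemOrliczHeart 1 (M.obs x) (fun y => f (M.upd b y) + payoffCoeff θ ϑ α * u y)) :
    Integrable (M.innerIntegrand θ ϑ α u f b) (M.obs x) := by
  by_cases h : ϑ = ∞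
  · simp only [payoffCoeff, h, if_true] at hY
    refine hY.integrable.congr (ae_of_all _ fun y => ?_)
    simp [innerIntegrand, h]
  · exact (hY.const_mul (θ / ϑ.toReal)).integrable_exp.congr
      (ae_of_all _ fun y => (innerIntegrand_of_ne_top hθ hϑ h y).symm)

/-- The outer power `ϑ / θ` cancels the factor `k = θ / ϑ` in the exponent. For `ϑ = ∞` the
conventions `∞.toReal = 0` and `θ / 0 = 0` give `k = 0`, where the certainty equivalent is the mean;
one formula covers both recursions. -/
theorem outerIntegrand_eq (hθ : 0 < θ) (hϑ : 0 < ϑ)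
    (hY : MemOrliczHeart 1 (M.obs x) (fun y => f (M.upd b y) + payoffCoeff θ ϑ α * u y)) :
    M.outerIntegrand θ ϑ α u f b x =
      Real.exp (M.innerCertEq (θ / ϑ.toReal) (fun y => payoffCoeff θ ϑ α * u y) f b x) := by
  by_cases h : ϑ = ∞
  · simp [outerIntegrand, innerIntegrand, innerCertEq, certEq, payoffCoeff, h]
  · have hϑ' := ENNReal.toReal_pos hϑ.ne' h
    have hk : θ / ϑ.toReal ≠ 0 := by positivity
    rw [outerIntegrand, if_neg h]
    simp only [innerIntegrand_of_ne_top hθ hϑ h]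
    rw [← exp_mul_certEq hk hY, ← Real.exp_mul, innerCertEq]
    congr 1
    field_simp

theorem distortObs_eq (hθ : 0 < θ) (hϑ : 0 < ϑ)
    (hY : MemOrliczHeart 1 (M.obs x) (fun y => f (M.upd b y) + payoffCoeff θ ϑ α * u y)) (y : Φ) :
    M.distortObs θ ϑ α u f b x y = Real.exp (θ / ϑ.toReal * (f (M.upd b y) +
      payoffCoeff θ ϑ α * u y -
        M.innerCertEq (θ / ϑ.toReal) (fun y => payoffCoeff θ ϑ α * u y) f b x)) := by
  by_cases h : ϑ = ∞
  · simp [distortObs, h]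
  · have hϑ' := ENNReal.toReal_pos hϑ.ne' h
    have hk : θ / ϑ.toReal ≠ 0 := by positivity
    rw [distortObs, if_neg h]
    simp only [innerIntegrand_of_ne_top hθ hϑ h]
    rw [← exp_mul_certEq hk hY, ← Real.exp_sub, innerCertEq, mul_sub]

variable {μ : Measure (Φ × B)} [IsProbabilityMeasure μ]

theorem IsStationary.hasFiniteExpectations (hμ : M.IsStationary μ) (hθ : 0 < θ) (hϑ : 0 < ϑ)
    (hu : MemOrliczHeart 1 μ.fst u) (hf : MemOrliczHeart 1 μ.snd f) :
    M.HasFiniteExpectations μ θ ϑ α u f := by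
  have hU := hu.const_mul (payoffCoeff θ ϑ α)
  filter_upwards [hμ.ae_memOrliczHeart_continuation hU hf,
    hμ.ae_memOrliczHeart_innerCertEq (k := θ / ϑ.toReal) (by positivity) hU hf] with b h1 h2
  refine ⟨h1.mono fun x hx => integrable_innerIntegrand hθ hϑ hx, h2.integrable_exp.congr ?_⟩
  filter_upwards [h1] with x hx
  exact (outerIntegrand_eq hθ hϑ hx).symm

theorem IsStationary.T_ae_eq (hμ : M.IsStationary μ) (hθ : 0 < θ) (hϑ : 0 < ϑ)
    (hu : MemOrliczHeart 1 μ.fst u) (hf : MemOrliczHeart 1 μ.snd f) :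
    M.T β θ ϑ α u f =ᵐ[μ.snd]
      M.recT β (θ / ϑ.toReal) 1 (fun y => payoffCoeff θ ϑ α * u y) f := by
  have hU := hu.const_mul (payoffCoeff θ ϑ α)
  filter_upwards [hμ.ae_memOrliczHeart_continuation hU hf] with b h1
  rw [T, recT, certEq, if_neg one_ne_zero, inv_one, one_mul]
  simp only [one_mul]
  congr 2
  refine integral_congr_ae ?_
  filter_upwards [h1] with x hx
  exact outerIntegrand_eq hθ hϑ hx

/-- Both densities are normalized exponentials, hence Gibbs densities. Only the densities are
rewritten, so `f` is arbitrary. -/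
theorem IsStationary.D_ae_eq (hμ : M.IsStationary μ) (hθ : 0 < θ) (hϑ : 0 < ϑ)
    (hu : MemOrliczHeart 1 μ.fst u) (hv : MemOrliczHeart 1 μ.snd v) (f : B → ℝ) :
    M.D β θ ϑ α u v f =ᵐ[μ.snd]
      M.recD β (θ / ϑ.toReal) 1 (fun y => payoffCoeff θ ϑ α * u y) v f := by
  have hU := hu.const_mul (payoffCoeff θ ϑ α)
  filter_upwards [hμ.ae_memOrliczHeart_continuation hU hv,
    hμ.ae_memOrliczHeart_innerCertEq (k := θ / ϑ.toReal) (by positivity) hU hv] with b h1 h2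
  have hout : ∫ x, M.outerIntegrand θ ϑ α u v b x ∂(M.post b) = Real.exp (certEq 1 (M.post b)
      (M.innerCertEq (θ / ϑ.toReal) (fun y => payoffCoeff θ ϑ α * u y) v b)) := by
    rw [← one_mul (certEq 1 _ _), exp_mul_certEq one_ne_zero h2]
    simp only [one_mul]
    refine integral_congr_ae ?_
    filter_upwards [h1] with x hx
    exact outerIntegrand_eq hθ hϑ hx
  rw [D, recD, gibbs]
  congr 1
  refine integral_congr_ae ?_
  filter_upwards [h1] with x hx
  have hpost : M.distortPost θ ϑ α u v b x = Real.exp (1 * (M.innerCertEq (θ / ϑ.toReal)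
      (fun y => payoffCoeff θ ϑ α * u y) v b x - certEq 1 (M.post b)
        (M.innerCertEq (θ / ϑ.toReal) (fun y => payoffCoeff θ ϑ α * u y) v b))) := by
    rw [distortPost, hout, outerIntegrand_eq hθ hϑ hx, one_mul, Real.exp_sub]
  simp only [mul_assoc, hpost]
  rw [integral_const_mul, innerGibbs, gibbs]
  congr 1
  refine integral_congr_ae (ae_of_all _ fun y => ?_)
  simp only [distortObs_eq hθ hϑ hx]
  rfl

end LearningModel

/-! ### Operators that agree almost everywhere on the heart. -/

section OperatorCongruence

variable {X : Type*} [MeasurableSpace X] {ρ : Measure X} {D D' : (X → ℝ) → X → ℝ}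

theorem iterate_ae_eq (hD : IsBoundedLinearOnHeart 1 ρ D)
    (h : ∀ f, MemOrliczHeart 1 ρ f → D' f =ᵐ[ρ] D f)
    (n : ℕ) {f : X → ℝ} (hf : MemOrliczHeart 1 ρ f) : D'^[n] f =ᵐ[ρ] D^[n] f := by
  induction n with
  | zero => exact EventuallyEq.rfl
  | succ n ih =>
    rw [Function.iterate_succ_apply', Function.iterate_succ_apply']
    have hn := memOrliczHeart_iterate hD.mapsTo n hf
    have hn' := hn.congr ih.symm
    exact (h _ hn').trans (hD.congr _ _ hn' hn ih)

theorem heartOpNorm_congr (h : ∀ f, MemOrliczHeart 1 ρ f → D' f =ᵐ[ρ] D f) :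
    heartOpNorm 1 ρ D' = heartOpNorm 1 ρ D := by
  unfold heartOpNorm
  refine iSup_congr fun f => iSup_congr fun hf => iSup_congr fun _ => luxNorm_congr (h f hf)

theorem IsBoundedLinearOnHeart.congr_ae [IsFiniteMeasure ρ] (hD : IsBoundedLinearOnHeart 1 ρ D)
    (h : ∀ f, MemOrliczHeart 1 ρ f → D' f =ᵐ[ρ] D f) : IsBoundedLinearOnHeart 1 ρ D' where
  mapsTo f hf := (hD.mapsTo f hf).congr (h f hf).symm
  congr f g hf hg hfg := (h f hf).trans ((hD.congr f g hf hg hfg).trans (h g hg).symm)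
  add f g hf hg := by
    filter_upwards [h _ (hf.add le_rfl hg), h f hf, h g hg, hD.add f g hf hg] with x h1 h2 h3 h4
    rw [h1, h2, h3, h4]
  smul a f hf := by
    filter_upwards [h _ (hf.const_mul a), h f hf, hD.smul a f hf] with x h1 h2 h3
    rw [h1, h2, h3]
  bounded := (heartOpNorm_congr h).trans_lt hD.bounded

theorem IsHeartSpectralRadius.congr_ae {R : ℝ≥0∞} (hR : IsHeartSpectralRadius 1 ρ D R)
    (hD : IsBoundedLinearOnHeart 1 ρ D)
    (h : ∀ f, MemOrliczHeart 1 ρ f → D' f =ᵐ[ρ] D f) : IsHeartSpectralRadius 1 ρ D' R := by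
  unfold IsHeartSpectralRadius at hR ⊢
  convert hR using 3 with n
  exact heartOpNorm_congr fun f hf => iterate_ae_eq hD h n hf

end OperatorCongruence

end

/-! ### The theorem. -/

theorem theorem2 {S Φ B : Type*} [MeasurableSpace S] [MeasurableSpace Φ] [MeasurableSpace B]
    (M : LearningModel S Φ B) (μ : Measure (Φ × B)) [IsProbabilityMeasure μ]
    (hμ : M.IsStationary μ)
    (β θ α : ℝ) (ϑ : ℝ≥0∞) (hβ0 : 0 < β) (hβ1 : β < 1) (hθ : 0 < θ) (hϑ : 0 < ϑ)
    (r : ℝ) (hr : 1 ≤ r) (u : Φ → ℝ) (hu : MemOrliczHeart r μ.fst u) :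
    -- `T` is a well-defined self-map of each of the spaces involved
    (∀ s : ℝ, 1 ≤ s → s ≤ r → ∀ f : B → ℝ, MemOrliczHeart s μ.snd f →
      M.HasFiniteExpectations μ θ ϑ α u f ∧ MemOrliczHeart s μ.snd (M.T β θ ϑ α u f)) ∧
    ∃ v : B → ℝ, M.IsFixedPointIn μ β θ ϑ α u r v ∧
      (1 < r →
        -- uniqueness in the smaller spaces
        (∀ s : ℝ, 1 < s → s ≤ r →
          M.IsFixedPointIn μ β θ ϑ α u s v ∧
          ∀ w : B → ℝ, M.IsFixedPointIn μ β θ ϑ α u s w → w =ᵐ[μ.snd] v) ∧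
        -- smallest and unique stable fixed point in the largest space
        M.IsFixedPointIn μ β θ ϑ α u 1 v ∧
        (∀ w : B → ℝ, M.IsFixedPointIn μ β θ ϑ α u 1 w → v ≤ᵐ[μ.snd] w) ∧
        M.IsStableIn μ β θ ϑ α u 1 v ∧
        (∀ w : B → ℝ, M.IsFixedPointIn μ β θ ϑ α u 1 w →
          M.IsStableIn μ β θ ϑ α u 1 w → w =ᵐ[μ.snd] v)) := by
  set k := θ / ϑ.toReal with hkdef
  have hk : 0 ≤ k := by positivity
  set U : Φ → ℝ := fun y => LearningModel.payoffCoeff θ ϑ α * u y with hUdef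
  have hU : MemOrliczHeart r μ.fst U := hu.const_mul _
  have hu1 := hu.of_le zero_le_one hr
  have hU1 := hU.of_le zero_le_one hr
  have hT : ∀ f, MemOrliczHeart 1 μ.snd f → M.T β θ ϑ α u f =ᵐ[μ.snd] M.recT β k 1 U f :=
    fun f hf => hμ.T_ae_eq hθ hϑ hu1 hf
  have hDD : ∀ w, MemOrliczHeart 1 μ.snd w → ∀ f,
      M.D β θ ϑ α u w f =ᵐ[μ.snd] M.recD β k 1 U w f :=
    fun w hw f => hμ.D_ae_eq hθ hϑ hu1 hw f
  refine ⟨fun s hs hsr f hf => ?_, ?_⟩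
  · have hf1 := hf.of_le zero_le_one hs
    exact ⟨hμ.hasFiniteExpectations hθ hϑ hu1 hf1, (hμ.memOrliczHeart_recT hk zero_le_one hs
      (hU.of_le (by linarith) hsr) hf).congr (hT f hf1).symm⟩
  -- The iteration requires a measurable payoff, so it runs with a measurable version of `U`; `hUU`
  -- carries the result back.
  obtain ⟨v, -, hv, hTv', hmin'⟩ := hμ.exists_least_fixedPoint hβ0 hβ1 hk zero_le_one hr
    hU.1.measurable_mk (hU.congr hU.1.ae_eq_mk)
  have hUU : ∀ f, M.recT β k 1 (hU.1.mk U) f =ᵐ[μ.snd] M.recT β k 1 U f := fun f =>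
    hμ.recT_congr hU.1.ae_eq_mk.symm .rfl
  have hTv := (hUU v).symm.trans hTv'
  have hv1 := hv.of_le zero_le_one hr
  have hfix : ∀ s, 1 ≤ s → s ≤ r → M.IsFixedPointIn μ β θ ϑ α u s v := fun s hs hsr =>
    ⟨hv.of_le (by linarith) hsr, (hT v hv1).trans hTv⟩
  have hmin : ∀ w, M.IsFixedPointIn μ β θ ϑ α u 1 w → v ≤ᵐ[μ.snd] w := fun w hw =>
    hmin' w hw.1 ((hUU w).trans ((hT w hw.1).symm.trans hw.2)).le
  have hstab : ∀ s, 1 < s → s ≤ r → ∀ w, MemOrliczHeart s μ.snd w →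
      M.IsStableIn μ β θ ϑ α u 1 w := by
    intro s hs hsr w hw
    have hw1 := hw.of_le zero_le_one hs.le
    obtain ⟨h1, h2⟩ := hμ.recD_stable hβ0 hk zero_le_one hs (hU.of_le (by linarith) hsr) hw
    exact ⟨h1.congr_ae fun f _ => hDD w hw1 f, _, h2.congr_ae h1 fun f _ => hDD w hw1 f,
      by simpa using hβ1⟩
  have huniq : ∀ w, M.IsFixedPointIn μ β θ ϑ α u 1 w → M.IsStableIn μ β θ ϑ α u 1 w →
      w =ᵐ[μ.snd] v := by
    rintro w hw ⟨h1, R, h2, h3⟩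
    have h4 := h1.congr_ae fun f _ => (hDD w hw.1 f).symm
    have h5 := h2.congr_ae h1 fun f _ => (hDD w hw.1 f).symm
    exact (hμ.le_of_stable hβ0 hk zero_le_one hU1 hv1 hw.1 hTv
      ((hT w hw.1).symm.trans hw.2) h4 h5 h3).antisymm (hmin w hw)
  refine ⟨v, hfix r hr le_rfl, fun hr1 => ⟨fun s hs hsr => ⟨hfix s hs.le hsr, fun w hw => ?_⟩,
    hfix 1 le_rfl hr, hmin, hstab r hr1 le_rfl v hv, huniq⟩⟩
  -- A fixed point of order `s > 1` is stable in the heart of order one, so uniqueness among stable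
  -- fixed points applies to it.
  exact huniq w ⟨hw.1.of_le zero_le_one hs.le, hw.2⟩ (hstab s hs hsr w hw.1)
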